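/- **Setting.** Let $M\ge 1$, $T\ge 0$ be integers, $N=TM$, $\sigma>0$, $\bm s\in\mathbb R^N$, and $\bm X\sim\mathcal N(\bm s,\sigma^2 I_N)$. Put $D=\lfloor M/2\rfloor+1$, $\omega_M=e^{-2\pi i/M}$, $\bm w^{(d)}=(\omega_M^{0},\omega_M^{d},\dots,\omega_M^{(M-1)d})^\top$, let $\bm 1_{a:b}\in\mathbb R^T$ be the indicator vector of positions $a,\dots,b$, and set $$F_t^{(d)}=(\bm 1_{t:t}\otimes\bm w^{(d)})^\top\bm X,\qquad \mu^{(d)}_t=\mathbb E[F^{(d)}_t],\qquad \bar F^{(d)}_{a:b}=\frac1{b-a+1}\sum_{t=a}^bF_t^{(d)} .$$ Let $c^{(d)}=1$ if $d\in\{0,M/2\}$ and $c^{(d)}=2$ otherwise. Let $\mathcal A$ be any measurable (deterministic) change-point candidate selection algorithm: it maps each $\bm x\in\mathbb R^N$ to a collection $\mathcal T=(\bm\tau^{(0)},\dots,\bm\tau^{(D-1)})$ of sets $\bm\tau^{(d)}\subseteq\{1,\dots,T-1\}$. For a collection $\mathcal T$ let $\tau_1<\dots<\tau_K$ be the elements of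 $\bigcup_d\bm\tau^{(d)}$. For $1\le k\le K$ let $\mathcal D_k=\{d:\tau_k\in\bm\tau^{(d)}\}$, and for $d\in\mathcal D_k$ let $\tau^{(d)}_{\rm pre}$ and $\tau^{(d)}_{\rm suc}$ be the elements of $\bm\tau^{(d)}\cup\{0,T\}$ immediately before and after $\tau_k$. The null hypothesis $\mathrm H_{0,k}$ for $\mathcal T$ is $$\frac1{\tau_k-\tau^{(d)}_{\rm pre}}\sum_{t=\tau^{(d)}_{\rm pre}+1}^{\tau_k}\mu^{(d)}_t=\frac1{\tau^{(d)}_{\rm suc}-\tau_k}\sum_{t=\tau_k+1}^{\tau^{(d)}_{\rm suc}}\mu^{(d)}_t\qquad\text{for all } d\in\mathcal D_k .$$ With $a^{(d)}=\frac{(\tau_{\rm suc}^{(d)}-\tau_k)(\tau_k-\tau_{\rm pre}^{(d)})}{\tau_{\rm suc}^{(d)}-\tau_{\rm pre}^{(d)}}$ define $$T_k(\bm X)=\sigma^{-1}\Bigl(\sum_{d\in\mathcal D_k}\tfrac{a^{(d)}c^{(d)}}{M}\bigl|\bar F^{(d)}_{\tau^{(d)}_{\rm pre}+1:\tau_k}-\bar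 F^{(d)}_{\tau_k+1:\tau^{(d)}_{\rm suc}}\bigr|^2\Bigr)^{1/2},\qquad P_k=\mathrm{Re}\sum_{d\in\mathcal D_k}\tfrac{a^{(d)}c^{(d)}}{M}\,\bm v^{(d)}\bm v^{(d)*},$$ $$\bm v^{(d)}=\tfrac{1}{\tau_k-\tau^{(d)}_{\rm pre}}\bigl(\bm 1_{\tau^{(d)}_{\rm pre}+1:\tau_k}\otimes\bm w^{(d)}\bigr)-\tfrac1{\tau^{(d)}_{\rm suc}-\tau_k}\bigl(\bm 1_{\tau_k+1:\tau^{(d)}_{\rm suc}}\otimes\bm w^{(d)}\bigr),$$ where $\bm v^{*}$ is the conjugate transpose, and $\mathcal V(\bm X)=\sigma P_k\bm X/\|P_k\bm X\|$, $\mathcal U(\bm X)=(I_N-P_k)\bm X$, $\mathcal Q(\bm X)=(\mathcal V(\bm X),\mathcal U(\bm X))$. The selective $p$-value of an observation $\bm x$ is $$p_k(\bm x)=\mathbb P\bigl(T_k(\bm X)\ge T_k(\bm x)\mid\mathcal A(\bm X)=\mathcal A(\bm x),\ \mathcal Q(\bm X)=\mathcal Q(\bm x)\bigr),$$ where $T_k$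 and $\mathcal Q$ are built from $\mathcal T=\mathcal A(\bm x)$ and the right-hand side is understood through the regular conditional distribution of $T_k(\bm X)$ given $\mathcal Q(\bm X)$ under $\mathbb P(\cdot\mid\mathcal A(\bm X)=\mathcal A(\bm x))$. For $r>0$ and $\mathcal Z\subseteq\mathbb R$, $\mathrm{TC}(r,\mathcal Z)$ denotes the $\chi$-distribution with $r$ degrees of freedom conditioned on $\mathcal Z$. **Theorem 2.** Let $k\ge1$. 1. Let $\mathcal T$ be a collection with $\mathbb P(\mathcal A(\bm X)=\mathcal T)>0$ and at least $k$ candidate locations, for which $\mathrm H_{0,k}$ holds. Then, for almost every $\bm x$ with respect to the law of $\bm X$ given $\mathcal A(\bm X)=\mathcal T$, $p_k(\bm x)$ is the mass that $\mathrm{TC}(\mathrm{tr}(P_k),\mathcal Z(\bm x))$ gives to $[T_k(\bm x),\infty)$, where $\mathcal Z(\bm x)=\{z\in\mathbb R:\mathcal A(\mathcal U(\bm x)+z\,\mathcal V(\bm x))=\mathcal A(\bm x)\}$; and $$\mathbb P\bigl(p_k(\bm X)\le\alpha\mid\mathcal A(\bm X)=\mathcal T\bigr)=\alpha\qquad\text{for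 all }\alpha\in(0,1).$$ 2. Consequently the selective $p$-value is marginally uniform: if the event $E$ that $\mathcal A(\bm X)$ has at least $k$ candidate locations and $\mathrm H_{0,k}$ holds for $\mathcal A(\bm X)$ has positive probability, then $\mathbb P(p_k(\bm X)\le\alpha\mid E)=\alpha$ for all $\alpha\in(0,1)$; in particular, if $\mathbb P(E)=1$, then $\mathbb P(p_k(\bm X)\le\alpha)=\alpha$ for all $\alpha\in(0,1)$. -/

import Mathlib

open MeasureTheory ProbabilityTheory Set
open scoped Matrix

noncomputable section

namespace SpectralCP

/-- The data space `ℝ^N` with `N = T * M`: `T` non-overlapping windows of width `M`. -/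
abbrev Data (M T : ℕ) : Type := EuclideanSpace ℝ (Fin (T * M))

/-- A collection of change point candidates: for each frequency `d ∈ {0, …, ⌊M/2⌋}` a set
`τ^(d) ⊆ {1, …, T-1}`. -/
abbrev Candidates (M T : ℕ) : Type :=
  Fin (M / 2 + 1) → ↥(Finset.Icc 1 (T - 1)).powerset

/-! ### Short-time Fourier transform -/

/-- `ω_M = exp(-2πi/M)`. -/
def omega (M : ℕ) : ℂ := Complex.exp (-(Complex.I * (2 * Real.pi / M)))

/-- The Kronecker product `1_{a:b} ⊗ w_M^(d)`. Entry `n` lies in window `n / M + 1 ∈ {1, …, T}`, at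
offset `n % M ∈ {0, …, M-1}` in that window. -/
def segVec (M T : ℕ) (d a b : ℕ) : Fin (T * M) → ℂ := fun n =>
  (if a ≤ (n.divNat : ℕ) + 1 ∧ (n.divNat : ℕ) + 1 ≤ b then 1 else 0) *
    omega M ^ ((n.modNat : ℕ) * d)

/-- The spectrum `F_t^(d) = (1_{t:t} ⊗ w_M^(d))ᵀ x` (no conjugation). -/
def spectrum (M T : ℕ) (d t : ℕ) (x : Data M T) : ℂ :=
  ∑ n, segVec M T d t t n * (x n : ℂ)

/-- The average of the spectra of frequency `d` over the windows `a, …, b`. -/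
def avgSpectrum (M T : ℕ) (d a b : ℕ) (x : Data M T) : ℂ :=
  (1 / ((b : ℂ) - a + 1)) * ∑ t ∈ Finset.Icc a b, spectrum M T d t x

/-- The mean spectrum `μ_t^(d) = 𝔼[F_t^(d)]` when the data have law `ν`. -/
def meanSpectrum {M T : ℕ} (ν : Measure (Data M T)) (d t : ℕ) : ℂ :=
  ∫ x, spectrum M T d t x ∂ν

/-- `c_sym^(d) = 1` if `d = 0` or `d = M/2`, and `2` otherwise. -/
def cSym (M d : ℕ) : ℝ := if d = 0 ∨ 2 * d = M then 1 else 2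

/-! ### Candidate locations -/

/-- The set of candidate locations `τ = ⋃_d τ^(d)`. -/
def locations {M T : ℕ} (𝒯 : Candidates M T) : Finset ℕ :=
  Finset.univ.biUnion fun d => (𝒯 d).1

/-- The `k`-th candidate location in increasing order, for `1 ≤ k ≤ K = |τ|`. -/
def loc {M T : ℕ} (𝒯 : Candidates M T) (k : ℕ) : ℕ :=
  Nat.nth (fun t => t ∈ locations 𝒯) (k - 1)

/-- `𝒟_k`: the frequencies at which the `k`-th location is a candidate. -/
def freqs {M T : ℕ} (𝒯 : Candidates M T) (k : ℕ) : Finset (Fin (M / 2 + 1)) :=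
  Finset.univ.filter fun d => loc 𝒯 k ∈ (𝒯 d).1

/-- The candidate of frequency `d` immediately before the `k`-th location (`0` if there is none). -/
def pre {M T : ℕ} (𝒯 : Candidates M T) (k : ℕ) (d : Fin (M / 2 + 1)) : ℕ :=
  ((𝒯 d).1.filter fun t => t < loc 𝒯 k).sup id

/-- The candidate of frequency `d` immediately after the `k`-th location (`T` if there is none). -/
def suc {M T : ℕ} (𝒯 : Candidates M T) (k : ℕ) (d : Fin (M / 2 + 1)) : ℕ :=
  (insert T ((𝒯 d).1.filter fun t => loc 𝒯 k < t)).min' (Finset.insert_nonempty _ _)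

/-- The null hypothesis `H_{0,k}` for the candidates `𝒯`, when the data have law `ν`: at every
frequency in `𝒟_k`, the mean spectra before and after the `k`-th location have equal averages. -/
def NullHyp {M T : ℕ} (ν : Measure (Data M T)) (𝒯 : Candidates M T) (k : ℕ) : Prop :=
  ∀ d ∈ freqs 𝒯 k,
    (1 / ((loc 𝒯 k : ℂ) - pre 𝒯 k d)) *
        ∑ t ∈ Finset.Icc (pre 𝒯 k d + 1) (loc 𝒯 k), meanSpectrum ν d t =
      (1 / ((suc 𝒯 k d : ℂ) - loc 𝒯 k)) *
        ∑ t ∈ Finset.Icc (loc 𝒯 k + 1) (suc 𝒯 k d), meanSpectrum ν d t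

/-! ### Test statistic, projection matrix, nuisance statistic -/

/-- `a_len^(d)`. -/
def aLen {M T : ℕ} (𝒯 : Candidates M T) (k : ℕ) (d : Fin (M / 2 + 1)) : ℝ :=
  ((suc 𝒯 k d : ℝ) - loc 𝒯 k) * ((loc 𝒯 k : ℝ) - pre 𝒯 k d) / ((suc 𝒯 k d : ℝ) - pre 𝒯 k d)

/-- The test statistic `T_k(x)` for the candidates `𝒯`. -/
def testStat {M T : ℕ} (σ : ℝ) (𝒯 : Candidates M T) (k : ℕ) (x : Data M T) : ℝ :=
  σ⁻¹ * √(∑ d ∈ freqs 𝒯 k, aLen 𝒯 k d * cSym M d / M *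
    ‖avgSpectrum M T d (pre 𝒯 k d + 1) (loc 𝒯 k) x -
      avgSpectrum M T d (loc 𝒯 k + 1) (suc 𝒯 k d) x‖ ^ 2)

/-- The vector `v^(d)`. -/
def contrastVec {M T : ℕ} (𝒯 : Candidates M T) (k : ℕ) (d : Fin (M / 2 + 1)) :
    Fin (T * M) → ℂ :=
  (1 / ((loc 𝒯 k : ℂ) - pre 𝒯 k d)) • segVec M T d (pre 𝒯 k d + 1) (loc 𝒯 k) -
    (1 / ((suc 𝒯 k d : ℂ) - loc 𝒯 k)) • segVec M T d (loc 𝒯 k + 1) (suc 𝒯 k d)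

/-- The real matrix `P_k`: the real part of `∑_{d ∈ 𝒟_k} (a_len c_sym / M) v v^*`. The real part
averages the contributions of the frequencies `d` and `M - d`, which are complex conjugate; it does
not change the quadratic form on real vectors. -/
def projMat {M T : ℕ} (𝒯 : Candidates M T) (k : ℕ) : Matrix (Fin (T * M)) (Fin (T * M)) ℝ :=
  (∑ d ∈ freqs 𝒯 k, ((aLen 𝒯 k d * cSym M d / M : ℝ) : ℂ) •
    Matrix.vecMulVec (contrastVec 𝒯 k d) (star (contrastVec 𝒯 k d))).map Complex.re

/-- `P_k x`. -/
def proj {M T : ℕ} (𝒯 : Candidates M T) (k : ℕ) (x : Data M T) : Data M T :=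
  WithLp.toLp 2 (projMat 𝒯 k *ᵥ x.ofLp)

/-- `𝒱(x) = σ P_k x / ‖P_k x‖`. -/
def nuisV {M T : ℕ} (σ : ℝ) (𝒯 : Candidates M T) (k : ℕ) (x : Data M T) : Data M T :=
  (σ / ‖proj 𝒯 k x‖) • proj 𝒯 k x

/-- `𝒰(x) = (I - P_k) x`. -/
def nuisU {M T : ℕ} (𝒯 : Candidates M T) (k : ℕ) (x : Data M T) : Data M T :=
  x - proj 𝒯 k x

/-- `𝒬(x) = (𝒱(x), 𝒰(x))`. -/
def nuisance {M T : ℕ} (σ : ℝ) (𝒯 : Candidates M T) (k : ℕ) (x : Data M T) :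
    Data M T × Data M T :=
  (nuisV σ 𝒯 k x, nuisU 𝒯 k x)

/-! ### Truncated chi distribution -/

/-- The `χ` distribution with `r > 0` degrees of freedom. -/
def chiMeasure (r : ℝ) : Measure ℝ :=
  (volume.restrict (Ioi 0)).withDensity fun z =>
    ENNReal.ofReal (z ^ (r - 1) * Real.exp (-z ^ 2 / 2) / (2 ^ (r / 2 - 1) * Real.Gamma (r / 2)))

/-- The truncated `χ` distribution: the `χ` distribution with `r` degrees of freedom conditioned
on `Z`. -/
def truncChi (r : ℝ) (Z : Set ℝ) : Measure ℝ := cond (chiMeasure r) Z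

/-- The truncation region `{z ∈ ℝ | 𝒜(a + b z) = 𝒜(x)}` with `a = 𝒰(x)`, `b = 𝒱(x)`. -/
def truncRegion {M T : ℕ} (σ : ℝ) (𝒜 : Data M T → Candidates M T) (k : ℕ) (x : Data M T) :
    Set ℝ :=
  {z | 𝒜 (nuisU (𝒜 x) k x + z • nuisV σ (𝒜 x) k x) = 𝒜 x}

/-! ### Selective p-value -/

/-- The selective p-value of the observation `x`, when the data `X` have law `ν`:
`ℙ(T_k(X) ≥ T_k(x) | 𝒜(X) = 𝒜(x), 𝒬(X) = 𝒬(x))`, where `T_k` and `𝒬` are built from the candidates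
`𝒜(x)`. It is the regular conditional distribution of `T_k(X)` given `𝒬(X)` under
`ℙ(· | 𝒜(X) = 𝒜(x))`, taken at `𝒬(x)` and evaluated on `[T_k(x), ∞)`. -/
def selectivePValue {M T : ℕ} (ν : Measure (Data M T)) (σ : ℝ) (𝒜 : Data M T → Candidates M T)
    (k : ℕ) (x : Data M T) : ℝ :=
  (condDistrib (testStat σ (𝒜 x) k) (nuisance σ (𝒜 x) k) (cond ν (𝒜 ⁻¹' {𝒜 x}))
    (nuisance σ (𝒜 x) k x)).real (Ici (testStat σ (𝒜 x) k x))

end SpectralCP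

end

namespace SpectralCP

/-! For fixed candidates, orthogonality of characters makes `P_k` an orthogonal projection, of rank
`tr P_k`, and `T_k(x) = ‖P_k x‖ / σ` (`projMat_mul_self`, `testStat_eq_norm_proj`). The null
hypothesis gives `P_k s = 0`, so `P_k X` is `σ` times a standard Gaussian on the range of `P_k`,
independent of `𝒰(X)`. In polar coordinates its norm is χ-distributed and independent of its
direction. Hence `T_k` is independent of `𝒬` (`exists_map_nuisance_testStat`).

Since `x = 𝒰(x) + T_k(x) 𝒱(x)`, selection is an event `(𝒬, T_k) ∈ S`. Conditioning an independent
pair on `S` turns the law of `T_k` given `𝒬 = q` into the χ law truncated to the section of `S` at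
`q` (`condDistrib_cond_preimage_ae_eq`). This law has no atoms, and the survival function of an
atomless law, evaluated at a sample from it, is uniform (`measure_survival_le`). Summing over the
finitely many collections gives the marginal claim.

Conditioning cancels constants, so the total mass of the χ density is never needed, only its
finiteness. -/

/-- The survival function of an atomless probability measure on `ℝ` is uniformly distributed under
that measure. -/
theorem measure_survival_le (μ : Measure ℝ) [IsProbabilityMeasure μ] (hμ : ∀ t, μ {t} = 0)
    {α : ℝ} (hα : α ∈ Ioo (0 : ℝ) 1) :
    μ {t | μ.real (Ici t) ≤ α} = ENNReal.ofReal α := by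
  have : NullSingletonClass μ := ⟨hμ⟩
  have hg : ∀ t, μ.real (Ici t) = 1 - cdf μ t := by
    intro t
    rw [cdf_eq_real, ← probReal_compl_eq_one_sub measurableSet_Iic, compl_Iic,
      measureReal_congr Ioi_ae_eq_Ici]
  have hcont : Continuous (cdf μ) := by
    rw [continuous_iff_continuousAt]
    intro t
    rw [(cdf μ).mono.continuousAt_iff_leftLim_eq_rightLim, (cdf μ).rightLim_eq]
    have h := (cdf μ).measure_singleton t
    rw [measure_cdf, hμ] at h
    have h1 := ENNReal.ofReal_eq_zero.1 h.symm
    exact le_antisymm ((cdf μ).mono.leftLim_le le_rfl) (by linarith)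
  -- By continuity some `t₀` has survival exactly `α`. The ray from `t₀` lies in the set `U` below,
  -- which gives the lower bound.
  obtain ⟨t₀, ht₀⟩ : ∃ t, cdf μ t = 1 - α := by
    apply mem_range_of_exists_le_of_exists_ge hcont
    · have := (tendsto_cdf_atBot μ).eventually_le_const (show (0:ℝ) < 1 - α by linarith [hα.2])
      exact this.exists
    · have := (tendsto_cdf_atTop μ).eventually_const_le (show 1 - α < (1:ℝ) by linarith [hα.1])
      exact this.exists
  set U : Set ℝ := {t | μ.real (Ici t) ≤ α} with hU
  have hUc : IsClosed U := by
    simp only [hU, hg]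
    exact isClosed_le (by fun_prop) continuous_const
  have ht₀U : t₀ ∈ U := by simp [hU, hg, ht₀]
  have hbdd : BddBelow U := by
    obtain ⟨b, hb⟩ := ((tendsto_cdf_atBot μ).eventually_lt_const
      (show (0:ℝ) < 1 - α by linarith [hα.2])).exists
    refine ⟨b, fun t ht => ?_⟩
    by_contra! hlt
    have h1 : 1 - cdf μ t ≤ α := by rw [← hg]; exact ht
    have h2 := (cdf μ).mono hlt.le
    linarith
  -- Closedness puts the left endpoint in `U`; as `U` lies in the ray from there, its mass is at
  -- most `α`.
  have hmem : sInf U ∈ U := hUc.csInf_mem ⟨t₀, ht₀U⟩ hbdd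
  have hle : μ.real U ≤ α :=
    (measureReal_mono (fun t ht => csInf_le hbdd ht)).trans hmem
  have hge : α ≤ μ.real U := by
    have h1 : μ.real (Ici t₀) = α := by rw [hg, ht₀]; ring
    rw [← h1]
    refine measureReal_mono (fun t ht => ?_)
    have h2 : μ.real (Ici t) ≤ μ.real (Ici t₀) := measureReal_mono (Ici_subset_Ici.2 ht)
    exact h2.trans h1.le
  rw [← le_antisymm hle hge, ofReal_measureReal]

/-! ### Truncation of independent pairs and uniformity of conditional p-values. -/

section Selective

variable {E 𝓠 : Type*} [MeasurableSpace E] [MeasurableSpace 𝓠]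

/-- The kernel sending `q` to the measure `ρ` conditioned on the section of `S` at `q`. -/
noncomputable def condSection (ρ : Measure ℝ) [IsFiniteMeasure ρ] {S : Set (𝓠 × ℝ)}
    (hS : MeasurableSet S) : Kernel 𝓠 ℝ where
  toFun q := cond ρ (Prod.mk q ⁻¹' S)
  measurable' := by
    refine Measure.measurable_of_measurable_coe _ fun B hB => ?_
    have h : ∀ q, cond ρ (Prod.mk q ⁻¹' S) B =
        (ρ (Prod.mk q ⁻¹' S))⁻¹ * ρ (Prod.mk q ⁻¹' (S ∩ Prod.snd ⁻¹' B)) := fun q => by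
      rw [cond_apply (measurable_prodMk_left hS)]; rfl
    simp_rw [h]
    exact (measurable_measure_prodMk_left hS).inv.mul
      (measurable_measure_prodMk_left (hS.inter (measurable_snd hB)))

instance isFiniteKernel_condSection (ρ : Measure ℝ) [IsFiniteMeasure ρ] {S : Set (𝓠 × ℝ)}
    (hS : MeasurableSet S) : IsFiniteKernel (condSection ρ hS) := by
  refine ⟨1, ENNReal.one_lt_top, fun q => ?_⟩
  change cond ρ (Prod.mk q ⁻¹' S) univ ≤ 1
  exact prob_le_one

/-- The first marginal of the restricted product has density `q ↦ ρ(S_q)` with respect to `η`, and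
this factor cancels the normaliser of `ρ` conditioned on `S_q`. Where `ρ(S_q) = 0` both sides
contribute nothing. -/
theorem map_eq_compProd_condSection (ρ : Measure ℝ) [IsFiniteMeasure ρ] (η : Measure 𝓠)
    [IsFiniteMeasure η] {S : Set (𝓠 × ℝ)} (hS : MeasurableSet S) :
    (η.prod ρ).restrict S = ((η.prod ρ).restrict S).fst ⊗ₘ condSection ρ hS := by
  have hfst : ((η.prod ρ).restrict S).fst = η.withDensity fun q => ρ (Prod.mk q ⁻¹' S) := by
    ext B hB
    rw [Measure.fst_apply hB, Measure.restrict_apply (measurable_fst hB),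
      withDensity_apply _ hB, Measure.prod_apply ((measurable_fst hB).inter hS),
      ← lintegral_indicator hB]
    congr 1 with q
    by_cases hq : q ∈ B
    · simp only [hq, indicator_of_mem]
      congr 1; ext t; simp [hq]
    · simp [hq, preimage, inter_def]
  ext C hC
  rw [Measure.compProd_apply hC, hfst, lintegral_withDensity_eq_lintegral_mul _
    (measurable_measure_prodMk_left hS) (Kernel.measurable_kernel_prodMk_left hC),
    Measure.restrict_apply hC, Measure.prod_apply (hC.inter hS)]
  congr 1 with q
  change _ = ρ (Prod.mk q ⁻¹' S) * cond ρ (Prod.mk q ⁻¹' S) (Prod.mk q ⁻¹' C)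
  rw [cond_apply (measurable_prodMk_left hS), ← mul_assoc]
  by_cases h0 : ρ (Prod.mk q ⁻¹' S) = 0
  · rw [h0, zero_mul, zero_mul]
    exact measure_mono_null (fun t ht => ht.2) h0
  · rw [ENNReal.mul_inv_cancel h0 (measure_ne_top _ _), one_mul, inter_comm]; rfl

/-- Truncation of an independent pair: if `Y` has law `ρ` independently of `Q`, then conditionally
on an event `(Q, Y) ∈ S` the conditional distribution of `Y` given `Q = q` is `ρ` conditioned on the
section of `S` at `q`. -/
theorem condDistrib_cond_preimage_ae_eq (ν : Measure E) [IsFiniteMeasure ν] {Q : E → 𝓠}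
    (hQ : Measurable Q) {Y : E → ℝ} (hY : Measurable Y) (ρ : Measure ℝ) [IsFiniteMeasure ρ]
    (η : Measure 𝓠) [IsFiniteMeasure η] (h : ν.map (fun x => (Q x, Y x)) = η.prod ρ)
    {S : Set (𝓠 × ℝ)} (hS : MeasurableSet S) {A : Set E}
    (hA : A = (fun x => (Q x, Y x)) ⁻¹' S) :
    ∀ᵐ q ∂((cond ν A).map Q), condDistrib Y Q (cond ν A) q = cond ρ (Prod.mk q ⁻¹' S) := by
  have hQY : Measurable fun x => (Q x, Y x) := hQ.prodMk hY
  have h1 : (cond ν A).map (fun x => (Q x, Y x)) = (ν A)⁻¹ • (η.prod ρ).restrict S := by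
    rw [ProbabilityTheory.cond, Measure.map_smul, hA, ← Measure.restrict_map hQY hS, h]
  have h2 : (cond ν A).map Q = (ν A)⁻¹ • ((η.prod ρ).restrict S).fst := by
    rw [← Measure.fst_map_prodMk hY, h1, Measure.fst, Measure.map_smul, Measure.fst]
  refine condDistrib_ae_eq_of_measure_eq_compProd (κ := condSection ρ hS) Q hY.aemeasurable ?_
  rw [h1, h2, Measure.compProd_smul_left, ← map_eq_compProd_condSection]

/-- The rays `Ici t` are the sections of one measurable set, so the p-value is jointly measurable in
the nuisance value and the statistic. -/
theorem measurable_kernel_real_Ici (κ : Kernel 𝓠 ℝ) [IsSFiniteKernel κ] :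
    Measurable fun p : 𝓠 × ℝ => (κ p.1).real (Ici p.2) := by
  have hs : MeasurableSet {p : (𝓠 × ℝ) × ℝ | p.1.2 ≤ p.2} :=
    measurableSet_le (by fun_prop) (by fun_prop)
  exact (Kernel.measurable_kernel_prodMk_left (κ := κ.prodMkRight ℝ) hs).ennreal_toReal

/-- A selective p-value with atomless conditional distributions is uniform. -/
theorem measure_condDistrib_Ici_le (μ : Measure E) [IsProbabilityMeasure μ] {Q : E → 𝓠}
    (hQ : Measurable Q) {Y : E → ℝ} (hY : Measurable Y)
    (hatom : ∀ᵐ q ∂(μ.map Q), ∀ t, condDistrib Y Q μ q {t} = 0) {α : ℝ}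
    (hα : α ∈ Ioo (0 : ℝ) 1) :
    μ {x | (condDistrib Y Q μ (Q x)).real (Ici (Y x)) ≤ α} = ENNReal.ofReal α := by
  have hs : MeasurableSet {p : 𝓠 × ℝ | (condDistrib Y Q μ p.1).real (Ici p.2) ≤ α} :=
    measurable_kernel_real_Ici _ measurableSet_Iic
  have h1 : μ {x | (condDistrib Y Q μ (Q x)).real (Ici (Y x)) ≤ α} =
      μ.map (fun x => (Q x, Y x)) {p | (condDistrib Y Q μ p.1).real (Ici p.2) ≤ α} := by
    rw [Measure.map_apply (hQ.prodMk hY) hs]; rfl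
  -- Disintegrating the joint law over `Q` reduces the claim to one atomless law per fibre.
  rw [h1, ← compProd_map_condDistrib hY.aemeasurable, Measure.compProd_apply hs]
  have : IsProbabilityMeasure (μ.map Q) := Measure.isProbabilityMeasure_map hQ.aemeasurable
  have h2 : ∀ᵐ q ∂(μ.map Q), condDistrib Y Q μ q
      (Prod.mk q ⁻¹' {p | (condDistrib Y Q μ p.1).real (Ici p.2) ≤ α}) = ENNReal.ofReal α := by
    filter_upwards [hatom] with q hq
    exact measure_survival_le _ hq hα
  rw [lintegral_congr_ae h2]
  simp

end Selective

/-! ### Standard Gaussian measure: density, orthogonal splitting, polar decomposition. -/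

section Gaussian

variable {E : Type*} [NormedAddCommGroup E] [InnerProductSpace ℝ E] [FiniteDimensional ℝ E]
  [MeasurableSpace E] [BorelSpace E]

open Module in
/-- The standard Gaussian measure has the density `(2π)^{-n/2} exp(-‖x‖²/2)`. -/
theorem stdGaussian_eq_withDensity :
    stdGaussian E = (volume : Measure E).withDensity fun x =>
      ENNReal.ofReal ((2 * Real.pi) ^ (-(finrank ℝ E : ℝ) / 2) * Real.exp (-‖x‖ ^ 2 / 2)) := by
  set C : ℝ := (2 * Real.pi) ^ (-(finrank ℝ E : ℝ) / 2) with hC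
  have hCpos : 0 < C := by positivity
  have hint : Integrable (fun x : E => C * Real.exp (-‖x‖ ^ 2 / 2)) := by
    have := GaussianFourier.integrable_cexp_neg_mul_sq_norm_add (V := E) (b := (1 / 2 : ℂ))
      (by norm_num) 0 0
    refine (this.norm.const_mul C).congr (Filter.Eventually.of_forall fun x => ?_)
    simp only [Complex.norm_exp]
    congr 2
    simp [← Complex.ofReal_pow]
    ring
  have : IsFiniteMeasure ((volume : Measure E).withDensity fun x =>
      ENNReal.ofReal (C * Real.exp (-‖x‖ ^ 2 / 2))) :=
    isFiniteMeasure_withDensity_ofReal hint.2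
  refine Measure.ext_of_charFun ?_
  ext t
  rw [charFun_stdGaussian, charFun_apply, integral_withDensity_eq_integral_toReal_smul
    (by fun_prop) (by simp)]
  have h := GaussianFourier.integral_cexp_neg_mul_sq_norm_add (V := E) (b := (1 / 2 : ℂ))
      (by norm_num) Complex.I t
  have h2 : ∀ x : E, (ENNReal.ofReal (C * Real.exp (-‖x‖ ^ 2 / 2))).toReal •
      Complex.exp (inner ℝ x t * Complex.I) =
      C * Complex.exp (-(1 / 2) * ‖x‖ ^ 2 + Complex.I * inner ℝ t x) := by
    intro x
    rw [ENNReal.toReal_ofReal (by positivity), Complex.real_smul, Complex.ofReal_mul,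
      Complex.ofReal_exp, mul_assoc, ← Complex.exp_add, real_inner_comm]
    congr 2
    push_cast
    ring
  simp_rw [h2]
  rw [integral_const_mul, h]
  -- `C` is the inverse of the Gaussian integral `(π / b)^{n/2}` at `b = 1/2`.
  have h3 : (C : ℂ) * (Real.pi / (1 / 2) : ℂ) ^ (finrank ℝ E / 2 : ℂ) = 1 := by
    have : (Real.pi / (1 / 2) : ℂ) ^ (finrank ℝ E / 2 : ℂ) =
        (((2 * Real.pi) ^ ((finrank ℝ E : ℝ) / 2) : ℝ) : ℂ) := by
      rw [Complex.ofReal_cpow (by positivity)]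
      push_cast
      congr 1; ring
    rw [this, ← Complex.ofReal_mul, hC, ← Real.rpow_add (by positivity)]
    rw [show -(finrank ℝ E : ℝ) / 2 + (finrank ℝ E : ℝ) / 2 = 0 by ring]
    simp
  rw [← mul_assoc, h3, one_mul]
  congr 1
  rw [Complex.I_sq]; ring

/-- The standard Gaussian measure is the law of the sum of independent standard Gaussian vectors in
two orthogonal complements. -/
theorem stdGaussian_eq_map_add (K : Submodule ℝ E) :
    stdGaussian E = ((stdGaussian Kᗮ).prod (stdGaussian K)).map
      (fun p : Kᗮ × K => (p.2 : E) + p.1) := by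
  refine Measure.ext_of_charFun ?_
  ext t
  have hm : Measurable fun p : Kᗮ × K => (p.2 : E) + p.1 := by fun_prop
  rw [charFun_stdGaussian, charFun_apply, integral_map hm.aemeasurable (by fun_prop)]
  -- Each summand sees only its own projection of `t`, so the characteristic function factors;
  -- Pythagoras then recombines the exponents.
  have h1 : ∀ p : Kᗮ × K, Complex.exp (inner ℝ ((p.2 : E) + p.1) t * Complex.I) =
      Complex.exp (inner ℝ p.1 (Kᗮ.orthogonalProjectionOnto t) * Complex.I) *
      Complex.exp (inner ℝ p.2 (K.orthogonalProjectionOnto t) * Complex.I) := by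
    intro p
    rw [← Complex.exp_add, ← add_mul, add_comm (p.2 : E), inner_add_left,
      Submodule.inner_orthogonalProjectionOnto_eq_of_mem_left,
      Submodule.inner_orthogonalProjectionOnto_eq_of_mem_left]
    push_cast; rfl
  simp_rw [h1]
  rw [integral_prod_mul
    (fun b : Kᗮ => Complex.exp (inner ℝ b (Kᗮ.orthogonalProjectionOnto t) * Complex.I))
    (fun a : K => Complex.exp (inner ℝ a (K.orthogonalProjectionOnto t) * Complex.I)),
    ← charFun_apply, ← charFun_apply, charFun_stdGaussian, charFun_stdGaussian, ← Complex.exp_add]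
  congr 1
  have := K.norm_sq_eq_add_norm_sq_projection t
  rw [← Complex.ofReal_pow, this]
  push_cast
  ring

instance isFiniteMeasure_chiMeasure (r : ℕ) [NeZero r] : IsFiniteMeasure (chiMeasure r) := by
  have hr : 0 < r := Nat.pos_of_neZero r
  refine isFiniteMeasure_withDensity_ofReal ?_
  have := (integrableOn_rpow_mul_exp_neg_mul_sq (b := 1 / 2) (by norm_num)
    (s := (r : ℝ) - 1) (by have : (0 : ℝ) < r := by exact_mod_cast hr
                           linarith)).div_const (2 ^ ((r : ℝ) / 2 - 1) * Real.Gamma ((r : ℝ) / 2))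
  refine Integrable.hasFiniteIntegral (this.congr (Filter.Eventually.of_forall fun x => ?_))
  simp only
  congr 3
  ring

theorem chiMeasure_singleton (r t : ℝ) : chiMeasure r {t} = 0 :=
  withDensity_absolutelyContinuous _ _ (by simp)

open Module in
/-- Polar decomposition of the standard Gaussian measure: the norm has a `χ` distribution and is
independent of the direction. -/
theorem exists_map_polar_stdGaussian [Nontrivial E] :
    ∃ θ : Measure E, IsFiniteMeasure θ ∧
      (stdGaussian E).map (fun x => (‖x‖⁻¹ • x, ‖x‖)) = θ.prod (chiMeasure (finrank ℝ E)) := by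
  set n := finrank ℝ E with hn
  have hnpos : 0 < n := finrank_pos
  have : NeZero n := ⟨hnpos.ne'⟩
  set C : ℝ := (2 * Real.pi) ^ (-(n : ℝ) / 2) with hC
  set G : ℝ := 2 ^ ((n : ℝ) / 2 - 1) * Real.Gamma ((n : ℝ) / 2) with hG
  have hGpos : 0 < G := by
    have : 0 < Real.Gamma ((n : ℝ) / 2) := Real.Gamma_pos_of_pos (by positivity)
    positivity
  have hCpos : 0 < C := by positivity
  -- The Gaussian constant `C` and the χ normaliser `G` are both absorbed into the angular measure,
  -- so the area of the sphere need not be computed.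
  set θ : Measure E := ENNReal.ofReal (C * G) •
    ((volume : Measure E).toSphere).map ((↑) : Metric.sphere (0 : E) 1 → E) with hθ
  have : IsFiniteMeasure θ := Measure.smul_finite _ ENNReal.ofReal_ne_top
  refine ⟨θ, inferInstance, ?_⟩
  have hm : Measurable fun x : E => (‖x‖⁻¹ • x, ‖x‖) := by fun_prop
  refine (Measure.prod_eq fun A B hA hB => ?_).symm
  rw [Measure.map_apply hm (hA.prod hB), stdGaussian_eq_withDensity,
    withDensity_apply _ (hm (hA.prod hB))]
  set f : ℝ → ENNReal := fun r => ENNReal.ofReal (C * Real.exp (-r ^ 2 / 2)) with hf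
  have hfm : Measurable f := by fun_prop
  have h1 : ∫⁻ x in (fun x : E => (‖x‖⁻¹ • x, ‖x‖)) ⁻¹' A ×ˢ B, f ‖x‖ =
      ∫⁻ x : E, A.indicator 1 (‖x‖⁻¹ • x) * B.indicator f ‖x‖ := by
    rw [← lintegral_indicator (hm (hA.prod hB))]
    congr 1 with x
    by_cases ha : ‖x‖⁻¹ • x ∈ A <;> by_cases hb : ‖x‖ ∈ B <;> simp [indicator, ha, hb]
  -- Polar coordinates live on the complement of the origin, which is a null set. The radial measure
  -- has density `r^(n-1)`.
  have h2 : ∫⁻ x : E, A.indicator 1 (‖x‖⁻¹ • x) * B.indicator f ‖x‖ =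
      ∫⁻ p : Metric.sphere (0 : E) 1 × Ioi (0 : ℝ), A.indicator 1 (p.1 : E) * B.indicator f p.2
        ∂((volume : Measure E).toSphere.prod (Measure.volumeIoiPow (n - 1))) := by
    rw [← (Measure.measurePreserving_homeomorphUnitSphereProd (volume : Measure E)).lintegral_comp_emb
      (Homeomorph.measurableEmbedding _)]
    conv_lhs => rw [← restrict_compl_singleton (μ := (volume : Measure E)) 0]
    rw [← lintegral_subtype_comap (measurableSet_singleton _).compl]
    simp
  change ∫⁻ x in (fun x : E => (‖x‖⁻¹ • x, ‖x‖)) ⁻¹' A ×ˢ B, f ‖x‖ = _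
  rw [h1, h2, lintegral_prod_mul (f := fun a : Metric.sphere (0 : E) 1 => A.indicator 1 (a : E))
    (g := fun r : Ioi (0 : ℝ) => B.indicator f r)
    ((measurable_one.indicator hA).comp measurable_subtype_coe).aemeasurable
    ((hfm.indicator hB).comp measurable_subtype_coe).aemeasurable]
  have h3 : ∫⁻ a : Metric.sphere (0 : E) 1, A.indicator 1 (a : E) ∂(volume : Measure E).toSphere =
      ((volume : Measure E).toSphere).map ((↑) : Metric.sphere (0 : E) 1 → E) A := by
    rw [← lintegral_indicator_one hA, lintegral_map (measurable_one.indicator hA)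
      measurable_subtype_coe]
  have h4 : ∫⁻ r : Ioi (0 : ℝ), B.indicator f r ∂Measure.volumeIoiPow (n - 1) =
      ENNReal.ofReal (C * G) * chiMeasure n B := by
    have hw : Measurable fun r : Ioi (0 : ℝ) => ENNReal.ofReal ((r : ℝ) ^ (n - 1)) := by fun_prop
    rw [Measure.volumeIoiPow, lintegral_withDensity_eq_lintegral_mul
      (g := fun r : Ioi (0 : ℝ) => B.indicator f r) _ hw
      ((hfm.indicator hB).comp measurable_subtype_coe)]
    have := lintegral_subtype_comap (μ := volume) (measurableSet_Ioi (a := (0 : ℝ)))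
      (fun r : ℝ => ENNReal.ofReal (r ^ (n - 1)) * B.indicator f r)
    refine this.trans ?_
    rw [chiMeasure, withDensity_apply _ hB, ← lintegral_indicator hB,
      ← lintegral_const_mul _ (by measurability)]
    refine setLIntegral_congr_fun measurableSet_Ioi fun r hr => ?_
    have hr : 0 < r := hr
    by_cases hb : r ∈ B
    · simp only [hb, indicator_of_mem, hf]
      rw [← ENNReal.ofReal_mul (by positivity), ← ENNReal.ofReal_mul (by positivity)]
      congr 1
      have : r ^ ((n : ℝ) - 1) = r ^ (n - 1) := by
        rw [← Real.rpow_natCast, Nat.cast_pred hnpos]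
      rw [this, ← hG]
      field_simp
    · simp [hb]
  rw [h3, h4, hθ, Measure.smul_apply, smul_eq_mul]
  ring

end Gaussian

/-! ### Roots of unity -/

theorem isPrimitiveRoot_omega {M : ℕ} (hM : 0 < M) : IsPrimitiveRoot (omega M) M := by
  have h := (Complex.isPrimitiveRoot_exp M hM.ne').inv
  rw [← Complex.exp_neg] at h
  rwa [omega, mul_comm Complex.I, div_mul_eq_mul_div]

theorem star_omega (M : ℕ) : star (omega M) = (omega M)⁻¹ := by
  rw [omega, ← Complex.exp_neg, Complex.star_def, ← Complex.exp_conj]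
  congr 1
  simp [Complex.conj_ofReal, map_ofNat]

theorem omega_ne_zero (M : ℕ) : omega M ≠ 0 := Complex.exp_ne_zero _

/-- A geometric sum. Integer exponents serve both products needed later: `d + d'` without
conjugation and `d' - d` with it. -/
theorem sum_omega_zpow {M : ℕ} (hM : 0 < M) (e : ℤ) :
    ∑ j : Fin M, (omega M ^ e) ^ (j : ℕ) = if (M : ℤ) ∣ e then (M : ℂ) else 0 := by
  rw [Fin.sum_univ_eq_sum_range (fun j => (omega M ^ e) ^ j) M]
  have hiff := (isPrimitiveRoot_omega hM).zpow_eq_one_iff_dvd e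
  split_ifs with h
  · rw [hiff.2 h]; simp
  · rw [geom_sum_eq (fun h1 => h (hiff.1 h1))]
    rw [← zpow_natCast, ← zpow_mul, mul_comm, zpow_mul, zpow_natCast,
      (isPrimitiveRoot_omega hM).pow_eq_one]
    simp

theorem sum_divNat_modNat {R : Type*} [AddCommMonoid R] {M T : ℕ} (f : Fin T → Fin M → R) :
    ∑ n : Fin (T * M), f n.divNat n.modNat = ∑ i, ∑ j, f i j := by
  rw [← Fintype.sum_prod_type']
  exact Fintype.sum_equiv finProdFinEquiv.symm _ _ fun n => rfl

/-! ### The contrast vectors -/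

/-- The contrast between the windows `p + 1, …, m` and the windows `m + 1, …, q`. -/
noncomputable def contrastWeight (p m q t : ℕ) : ℝ :=
  1 / ((m : ℝ) - p) * (if p + 1 ≤ t ∧ t ≤ m then 1 else 0) -
    1 / ((q : ℝ) - m) * (if m + 1 ≤ t ∧ t ≤ q then 1 else 0)

theorem sum_indicator_window {T p m : ℕ} (hpm : p ≤ m) (hm : m ≤ T) :
    ∑ i : Fin T, (if p + 1 ≤ (i : ℕ) + 1 ∧ (i : ℕ) + 1 ≤ m then (1 : ℝ) else 0) = m - p := by
  rw [Fin.sum_univ_eq_sum_range (fun i => if p + 1 ≤ i + 1 ∧ i + 1 ≤ m then (1 : ℝ) else 0) T,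
    Finset.sum_boole]
  have : {x ∈ Finset.range T | p + 1 ≤ x + 1 ∧ x + 1 ≤ m} = Finset.Ico p m := by
    ext x; simp; omega
  rw [this, Nat.card_Ico, Nat.cast_sub hpm]

/-- The two windows are disjoint, so no cross term appears. The value is the reciprocal of `a_len`.
-/
theorem sum_contrastWeight_sq {T p m q : ℕ} (hpm : p < m) (hmq : m < q) (hq : q ≤ T) :
    ∑ i : Fin T, contrastWeight p m q ((i : ℕ) + 1) ^ 2 =
      ((q : ℝ) - p) / (((q : ℝ) - m) * ((m : ℝ) - p)) := by
  have h : ∀ i : Fin T, contrastWeight p m q ((i : ℕ) + 1) ^ 2 =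
      (1 / ((m : ℝ) - p)) ^ 2 * (if p + 1 ≤ (i : ℕ) + 1 ∧ (i : ℕ) + 1 ≤ m then 1 else 0) +
      (1 / ((q : ℝ) - m)) ^ 2 * (if m + 1 ≤ (i : ℕ) + 1 ∧ (i : ℕ) + 1 ≤ q then 1 else 0) := by
    intro i
    rw [contrastWeight]
    split_ifs with h1 h2
    · omega
    all_goals ring
  simp_rw [h]
  rw [Finset.sum_add_distrib, ← Finset.mul_sum, ← Finset.mul_sum,
    sum_indicator_window hpm.le (by omega), sum_indicator_window hmq.le hq]
  have h1 : (0 : ℝ) < m - p := by simpa using hpm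
  have h2 : (0 : ℝ) < q - m := by simpa using hmq
  field_simp
  ring

section Candidates

variable {M T : ℕ} (𝒯 : Candidates M T) (k : ℕ) (d : Fin (M / 2 + 1))

theorem contrastVec_apply (n : Fin (T * M)) : contrastVec 𝒯 k d n =
    (contrastWeight (pre 𝒯 k d) (loc 𝒯 k) (suc 𝒯 k d) ((n.divNat : ℕ) + 1) : ℂ) *
      omega M ^ ((n.modNat : ℕ) * d) := by
  simp only [contrastVec, segVec, contrastWeight, Pi.sub_apply, Pi.smul_apply, smul_eq_mul]
  push_cast [apply_ite Complex.ofReal]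
  ring

/-- The Kronecker structure splits the product into a sum over windows and a character sum over
offsets. -/
theorem dotProduct_contrastVec (hM : 0 < M) (d' : Fin (M / 2 + 1)) :
    contrastVec 𝒯 k d ⬝ᵥ contrastVec 𝒯 k d' =
      (∑ i : Fin T, (contrastWeight (pre 𝒯 k d) (loc 𝒯 k) (suc 𝒯 k d) ((i : ℕ) + 1) : ℂ) *
        contrastWeight (pre 𝒯 k d') (loc 𝒯 k) (suc 𝒯 k d') ((i : ℕ) + 1)) *
        if (M : ℤ) ∣ (d : ℤ) + d' then (M : ℂ) else 0 := by
  rw [← sum_omega_zpow hM, Finset.sum_mul_sum, ← sum_divNat_modNat, dotProduct]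
  refine Finset.sum_congr rfl fun n _ => ?_
  rw [contrastVec_apply, contrastVec_apply, ← Nat.cast_add, zpow_natCast, ← pow_mul]
  ring

theorem star_dotProduct_contrastVec (hM : 0 < M) (d' : Fin (M / 2 + 1)) :
    star (contrastVec 𝒯 k d) ⬝ᵥ contrastVec 𝒯 k d' =
      (∑ i : Fin T, (contrastWeight (pre 𝒯 k d) (loc 𝒯 k) (suc 𝒯 k d) ((i : ℕ) + 1) : ℂ) *
        contrastWeight (pre 𝒯 k d') (loc 𝒯 k) (suc 𝒯 k d') ((i : ℕ) + 1)) *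
        if (M : ℤ) ∣ (d' : ℤ) - d then (M : ℂ) else 0 := by
  rw [← sum_omega_zpow hM, Finset.sum_mul_sum, ← sum_divNat_modNat, dotProduct]
  refine Finset.sum_congr rfl fun n _ => ?_
  rw [Pi.star_apply, contrastVec_apply, contrastVec_apply, zpow_sub₀ (omega_ne_zero M),
    zpow_natCast, zpow_natCast, star_mul', star_pow, star_omega, div_pow, ← pow_mul, ← pow_mul,
    inv_pow, mul_comm (d : ℕ), mul_comm (d' : ℕ), Complex.star_def, Complex.conj_ofReal]
  ring

variable {𝒯 k d}

theorem mem_freqs : d ∈ freqs 𝒯 k ↔ loc 𝒯 k ∈ (𝒯 d).1 := by simp [freqs]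

theorem loc_bounds (hd : d ∈ freqs 𝒯 k) : 1 ≤ loc 𝒯 k ∧ loc 𝒯 k ≤ T - 1 :=
  Finset.mem_Icc.1 (Finset.mem_powerset.1 (𝒯 d).2 (mem_freqs.1 hd))

theorem pre_lt_loc (hd : d ∈ freqs 𝒯 k) : pre 𝒯 k d < loc 𝒯 k := by
  rw [pre, Finset.sup_lt_iff (show ⊥ < _ from (loc_bounds hd).1)]
  intro t ht
  exact (Finset.mem_filter.1 ht).2

theorem loc_lt_suc (hd : d ∈ freqs 𝒯 k) : loc 𝒯 k < suc 𝒯 k d := by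
  rw [suc, Finset.lt_min'_iff]
  intro t ht
  rcases Finset.mem_insert.1 ht with rfl | ht
  -- The default `T` lies strictly after the location: `1 ≤ loc ≤ T - 1` rules out truncated
  -- subtraction.
  · have := loc_bounds hd; omega
  · exact (Finset.mem_filter.1 ht).2

theorem suc_le : suc 𝒯 k d ≤ T := Finset.min'_le _ _ (Finset.mem_insert_self _ _)

theorem freqs_nonempty (hk : k ∈ Finset.Icc 1 (locations 𝒯).card) : (freqs 𝒯 k).Nonempty := by
  rw [Finset.mem_Icc] at hk
  have h : loc 𝒯 k ∈ locations 𝒯 := by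
    -- `k ≤ K` keeps `Nat.nth` off its default value 0, which need not be a candidate.
    refine Nat.nth_mem (p := fun t => t ∈ locations 𝒯) (k - 1) fun hf => ?_
    have : hf.toFinset = locations 𝒯 := by ext; simp
    rw [this]; omega
  obtain ⟨d, -, hd⟩ := Finset.mem_biUnion.1 h
  exact ⟨d, mem_freqs.2 hd⟩

/-- The weight of the frequency `d` in the projection matrix. -/
noncomputable def freqWeight (𝒯 : Candidates M T) (k : ℕ) (d : Fin (M / 2 + 1)) : ℝ :=
  aLen 𝒯 k d * cSym M d / M

theorem cSym_pos (M d : ℕ) : 0 < cSym M d := by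
  rw [cSym]; split_ifs <;> norm_num

theorem aLen_pos (hd : d ∈ freqs 𝒯 k) : 0 < aLen 𝒯 k d := by
  have h1 : (pre 𝒯 k d : ℝ) < loc 𝒯 k := by exact_mod_cast pre_lt_loc hd
  have h2 : (loc 𝒯 k : ℝ) < suc 𝒯 k d := by exact_mod_cast loc_lt_suc hd
  exact div_pos (mul_pos (by linarith) (by linarith)) (by linarith)

theorem freqWeight_pos (hM : 0 < M) (hd : d ∈ freqs 𝒯 k) : 0 < freqWeight 𝒯 k d := by
  have := aLen_pos hd
  have := cSym_pos M d
  rw [freqWeight]; positivity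

theorem star_dotProduct_contrastVec_self (hM : 0 < M) (hd : d ∈ freqs 𝒯 k) :
    star (contrastVec 𝒯 k d) ⬝ᵥ contrastVec 𝒯 k d = ((M / aLen 𝒯 k d : ℝ) : ℂ) := by
  rw [star_dotProduct_contrastVec _ _ _ hM, sub_self, if_pos (dvd_zero _)]
  have h := sum_contrastWeight_sq (pre_lt_loc hd) (loc_lt_suc hd) (suc_le (𝒯 := 𝒯) (k := k))
  simp_rw [← Complex.ofReal_mul, ← Complex.ofReal_sum, ← pow_two, h]
  rw [aLen, ← Complex.ofReal_natCast, ← Complex.ofReal_mul]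
  congr 1
  rw [div_div_eq_mul_div]; ring

/-- As `2d ≤ M`, divisibility of `2d` by `M` leaves only `d = 0` and `d = M/2`. These are the
frequencies with `c_sym = 1`. -/
theorem dotProduct_contrastVec_self (hM : 0 < M) (hd : d ∈ freqs 𝒯 k) :
    contrastVec 𝒯 k d ⬝ᵥ contrastVec 𝒯 k d =
      if (d : ℕ) = 0 ∨ 2 * (d : ℕ) = M then ((M / aLen 𝒯 k d : ℝ) : ℂ) else 0 := by
  have hiff : (M : ℤ) ∣ (d : ℤ) + d ↔ ((d : ℕ) = 0 ∨ 2 * (d : ℕ) = M) := by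
    have := d.2
    rw [← Nat.cast_add, Int.natCast_dvd_natCast]
    constructor
    · rintro ⟨c, hc⟩
      have hc2 : c < 2 := by
        by_contra! h
        have := Nat.mul_le_mul_left M h
        omega
      interval_cases c <;> omega
    · rintro (h | h)
      · simp [h]
      · exact ⟨1, by omega⟩
  rw [← star_dotProduct_contrastVec_self hM hd, star_dotProduct_contrastVec _ _ _ hM, sub_self,
    if_pos (dvd_zero _), dotProduct_contrastVec _ _ _ hM]
  simp only [hiff]
  split_ifs <;> simp

/-- Distinct `d, d' ≤ M/2` satisfy `0 < d + d' < M`, so the character sum vanishes whatever the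
window weights are. Neighbouring candidates may thus differ between frequencies. -/
theorem dotProduct_contrastVec_of_ne (hM : 0 < M) {d' : Fin (M / 2 + 1)} (hne : d ≠ d') :
    contrastVec 𝒯 k d ⬝ᵥ contrastVec 𝒯 k d' = 0 := by
  have hne' : (d : ℕ) ≠ d' := fun h => hne (Fin.ext h)
  rw [dotProduct_contrastVec _ _ _ hM, if_neg, mul_zero]
  rw [← Nat.cast_add, Int.natCast_dvd_natCast]
  intro h
  have := Nat.le_of_dvd (by omega) h
  have := d.2
  have := d'.2
  omega

theorem star_dotProduct_contrastVec_of_ne (hM : 0 < M) {d' : Fin (M / 2 + 1)} (hne : d ≠ d') :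
    star (contrastVec 𝒯 k d) ⬝ᵥ contrastVec 𝒯 k d' = 0 := by
  have hne' : (d : ℕ) ≠ d' := fun h => hne (Fin.ext h)
  rw [star_dotProduct_contrastVec _ _ _ hM, if_neg, mul_zero]
  intro h
  have h1 := Int.le_of_dvd (a := M) (b := |(d' : ℤ) - d|) (by
    rw [abs_pos]; omega) ((dvd_abs _ _).2 h)
  have := d.2
  have := d'.2
  rcases abs_cases ((d' : ℤ) - d) with ⟨h2, -⟩ | ⟨h2, -⟩ <;> omega

end Candidates

/-! ### Real and imaginary parts -/

section ReIm

variable {ι : Type*} [Fintype ι]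

/-- The real parts of the entries of a complex vector. -/
def vecRe (v : ι → ℂ) : ι → ℝ := fun n => (v n).re

/-- The imaginary parts of the entries of a complex vector. -/
def vecIm (v : ι → ℂ) : ι → ℝ := fun n => (v n).im

theorem dotProduct_eq_re_im (v w : ι → ℂ) : v ⬝ᵥ w =
    (vecRe v ⬝ᵥ vecRe w - vecIm v ⬝ᵥ vecIm w : ℝ) +
      (vecRe v ⬝ᵥ vecIm w + vecIm v ⬝ᵥ vecRe w : ℝ) * Complex.I := by
  apply Complex.ext <;>
    simp [dotProduct, vecRe, vecIm, Finset.sum_sub_distrib, Finset.sum_add_distrib]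

theorem star_dotProduct_eq_re_im (v w : ι → ℂ) : star v ⬝ᵥ w =
    (vecRe v ⬝ᵥ vecRe w + vecIm v ⬝ᵥ vecIm w : ℝ) +
      (vecRe v ⬝ᵥ vecIm w - vecIm v ⬝ᵥ vecRe w : ℝ) * Complex.I := by
  apply Complex.ext <;>
    simp [dotProduct, vecRe, vecIm, Finset.sum_add_distrib, sub_eq_add_neg]

/-- `Re (v v^*)`. -/
def rePart (v : ι → ℂ) : Matrix ι ι ℝ :=
  Matrix.vecMulVec (vecRe v) (vecRe v) + Matrix.vecMulVec (vecIm v) (vecIm v)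

theorem rePart_mulVec (v : ι → ℂ) (x : ι → ℝ) :
    rePart v *ᵥ x = (vecRe v ⬝ᵥ x) • vecRe v + (vecIm v ⬝ᵥ x) • vecIm v := by
  rw [rePart, Matrix.add_mulVec, Matrix.vecMulVec_mulVec, Matrix.vecMulVec_mulVec]
  simp only [op_smul_eq_smul]

/-- Sums and differences of the two complex relations make the real and imaginary parts of `v`
orthogonal to those of `w`. -/
theorem rePart_mul_of_orthogonal {v w : ι → ℂ} (h1 : v ⬝ᵥ w = 0) (h2 : star v ⬝ᵥ w = 0) :
    rePart v * rePart w = 0 := by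
  rw [dotProduct_eq_re_im] at h1
  rw [star_dotProduct_eq_re_im] at h2
  have a1 := congrArg Complex.re h1
  have a2 := congrArg Complex.im h1
  have a3 := congrArg Complex.re h2
  have a4 := congrArg Complex.im h2
  simp only [Complex.add_re, Complex.add_im, Complex.ofReal_re, Complex.ofReal_im,
    Complex.re_ofReal_mul, Complex.im_ofReal_mul, Complex.I_re, Complex.I_im, Complex.zero_re, Complex.zero_im,
    mul_zero, mul_one, add_zero, zero_add] at a1 a2 a3 a4
  have b1 : vecRe v ⬝ᵥ vecRe w = 0 := by linarith
  have b2 : vecIm v ⬝ᵥ vecIm w = 0 := by linarith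
  have b3 : vecRe v ⬝ᵥ vecIm w = 0 := by linarith
  have b4 : vecIm v ⬝ᵥ vecRe w = 0 := by linarith
  simp only [rePart, add_mul, mul_add, Matrix.vecMulVec_mul_vecMulVec, b1, b2, b3, b4]
  simp

/-- `v ⬝ᵥ v = 0` makes the real and imaginary parts orthogonal with equal squared norm `r / 2`. This
halving is what `c_sym = 2` compensates. -/
theorem rePart_mul_self {v : ι → ℂ} {r : ℝ}
    (h2 : star v ⬝ᵥ v = (r : ℂ)) (h1 : v ⬝ᵥ v = 0) :
    (2 : ℝ) • (rePart v * rePart v) = r • rePart v := by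
  rw [dotProduct_eq_re_im] at h1
  rw [star_dotProduct_eq_re_im] at h2
  have a1 := congrArg Complex.re h1
  have a2 := congrArg Complex.im h1
  have a3 := congrArg Complex.re h2
  simp only [Complex.add_re, Complex.add_im, Complex.ofReal_re, Complex.ofReal_im,
    Complex.re_ofReal_mul, Complex.im_ofReal_mul, Complex.I_re, Complex.I_im, Complex.zero_re, Complex.zero_im,
    mul_zero, mul_one, add_zero, zero_add] at a1 a2 a3
  have b0 : vecIm v ⬝ᵥ vecRe v = vecRe v ⬝ᵥ vecIm v := dotProduct_comm _ _
  have b1 : vecRe v ⬝ᵥ vecRe v = r / 2 := by linarith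
  have b2 : vecIm v ⬝ᵥ vecIm v = r / 2 := by linarith
  have b3 : vecRe v ⬝ᵥ vecIm v = 0 := by linarith
  simp only [rePart, add_mul, mul_add, Matrix.vecMulVec_mul_vecMulVec, b0, b1, b2, b3]
  ext i j
  simp [Matrix.vecMulVec_apply]
  ring

/-- Agreement of the two products forces the imaginary part to vanish. -/
theorem rePart_mul_self_of_real {v : ι → ℂ} {r : ℝ}
    (h2 : star v ⬝ᵥ v = (r : ℂ)) (h1 : v ⬝ᵥ v = (r : ℂ)) :
    rePart v * rePart v = r • rePart v := by
  rw [dotProduct_eq_re_im] at h1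
  rw [star_dotProduct_eq_re_im] at h2
  have a1 := congrArg Complex.re h1
  have a3 := congrArg Complex.re h2
  simp only [Complex.add_re, Complex.ofReal_re, Complex.re_ofReal_mul, Complex.I_re, mul_zero,
    add_zero] at a1 a3
  have b1 : vecRe v ⬝ᵥ vecRe v = r := by linarith
  have b2 : vecIm v = 0 := dotProduct_self_eq_zero.1 (by linarith)
  simp only [rePart, add_mul, mul_add, Matrix.vecMulVec_mul_vecMulVec, b1, b2]
  ext i j
  simp [Matrix.vecMulVec_apply]

theorem trace_rePart (v : ι → ℂ) : ((rePart v).trace : ℂ) = star v ⬝ᵥ v := by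
  rw [star_dotProduct_eq_re_im, rePart, Matrix.trace_add, Matrix.trace_vecMulVec,
    Matrix.trace_vecMulVec, dotProduct_comm (vecIm v) (vecRe v), sub_self]
  simp

end ReIm

/-! ### The projection matrix -/

section Projection

variable {M T : ℕ} (𝒯 : Candidates M T) (k : ℕ)

theorem projMat_eq_sum :
    projMat 𝒯 k = ∑ d ∈ freqs 𝒯 k, freqWeight 𝒯 k d • rePart (contrastVec 𝒯 k d) := by
  ext i j
  simp only [projMat, Matrix.map_apply, Matrix.sum_apply, Complex.re_sum, Matrix.smul_apply,
    smul_eq_mul, Complex.re_ofReal_mul]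
  refine Finset.sum_congr rfl fun d _ => ?_
  simp [freqWeight, rePart, vecRe, vecIm, Matrix.vecMulVec_apply]

theorem projMat_transpose : (projMat 𝒯 k)ᵀ = projMat 𝒯 k := by
  rw [projMat_eq_sum, Matrix.transpose_sum]
  refine Finset.sum_congr rfl fun d _ => ?_
  rw [Matrix.transpose_smul, rePart, Matrix.transpose_add, Matrix.transpose_vecMulVec,
    Matrix.transpose_vecMulVec]

/-- Cross terms vanish by orthogonality. Each diagonal term is idempotent because its weight times
`‖v‖² = M / a_len` equals `c_sym`: 1 for real `v`, and 2 otherwise. -/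
theorem projMat_mul_self (hM : 0 < M) : projMat 𝒯 k * projMat 𝒯 k = projMat 𝒯 k := by
  rw [projMat_eq_sum, Finset.sum_mul_sum]
  refine Finset.sum_congr rfl fun d hd => ?_
  rw [Finset.sum_eq_single_of_mem d hd fun d' _ hne => by
    rw [Matrix.smul_mul, Matrix.mul_smul, rePart_mul_of_orthogonal
      (dotProduct_contrastVec_of_ne hM hne.symm) (star_dotProduct_contrastVec_of_ne hM hne.symm)]
    simp]
  have h2 := star_dotProduct_contrastVec_self hM hd
  have h1 := dotProduct_contrastVec_self hM hd
  have ha := aLen_pos hd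
  have hM' : (0 : ℝ) < M := by exact_mod_cast hM
  rw [Matrix.smul_mul, Matrix.mul_smul]
  by_cases hc : (d : ℕ) = 0 ∨ 2 * (d : ℕ) = M
  · rw [if_pos hc] at h1
    have hl : freqWeight 𝒯 k d * (M / aLen 𝒯 k d) = 1 := by
      rw [freqWeight, cSym, if_pos hc]; field_simp
    rw [rePart_mul_self_of_real h2 h1, smul_smul (freqWeight 𝒯 k d) (M / aLen 𝒯 k d), hl, one_smul]
  · rw [if_neg hc] at h1
    have hl : freqWeight 𝒯 k d * (M / aLen 𝒯 k d) = 2 := by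
      rw [freqWeight, cSym, if_neg hc]; field_simp
    have h3 := rePart_mul_self h2 h1
    have h4 : rePart (contrastVec 𝒯 k d) * rePart (contrastVec 𝒯 k d) =
        ((M / aLen 𝒯 k d) / 2) • rePart (contrastVec 𝒯 k d) := by
      rw [div_eq_inv_mul, mul_smul, ← h3, smul_smul]; norm_num
    have h5 : freqWeight 𝒯 k d * freqWeight 𝒯 k d * (M / aLen 𝒯 k d / 2) = freqWeight 𝒯 k d := by
      linear_combination (freqWeight 𝒯 k d / 2) * hl
    rw [h4, smul_smul (freqWeight 𝒯 k d), smul_smul, h5]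

theorem trace_projMat_pos (hM : 0 < M) (h : (freqs 𝒯 k).Nonempty) : 0 < (projMat 𝒯 k).trace := by
  rw [projMat_eq_sum, Matrix.trace_sum]
  refine Finset.sum_pos (fun d hd => ?_) h
  rw [Matrix.trace_smul, smul_eq_mul]
  refine mul_pos (freqWeight_pos hM hd) ?_
  have := trace_rePart (contrastVec 𝒯 k d)
  rw [star_dotProduct_contrastVec_self hM hd] at this
  rw [Complex.ofReal_injective this]
  have := aLen_pos hd
  positivity

/-- The projection as a linear map. -/
noncomputable def projLin : Data M T →ₗ[ℝ] Data M T := Matrix.toEuclideanLin (projMat 𝒯 k)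

theorem projLin_apply (x : Data M T) : projLin 𝒯 k x = proj 𝒯 k x := rfl

theorem isSymmetricProjection_projLin (hM : 0 < M) : (projLin 𝒯 k).IsSymmetricProjection := by
  refine ⟨?_, ?_⟩
  · change projLin 𝒯 k ∘ₗ projLin 𝒯 k = _
    ext x : 1
    simp only [LinearMap.comp_apply, projLin_apply, proj, Matrix.mulVec_mulVec,
      projMat_mul_self 𝒯 k hM]
  · rw [projLin, Matrix.isSymmetric_toEuclideanLin_iff, Matrix.IsHermitian,
      Matrix.conjTranspose_eq_transpose_of_trivial, projMat_transpose]

/-- The subspace onto which `P_k` projects. -/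
noncomputable def projRange : Submodule ℝ (Data M T) := (projLin 𝒯 k).range

theorem proj_eq_starProjection (hM : 0 < M) (x : Data M T) :
    proj 𝒯 k x = (projRange 𝒯 k).starProjection x := by
  have h := (LinearMap.isSymmetricProjection_iff_eq_coe_starProjection_range.1
    (isSymmetricProjection_projLin 𝒯 k hM)).2
  rw [← projLin_apply]
  exact LinearMap.congr_fun h x

theorem trace_projMat (hM : 0 < M) :
    (projMat 𝒯 k).trace = Module.finrank ℝ (projRange 𝒯 k) := by
  have h := (LinearMap.IsIdempotentElem.isProj_range _
    (isSymmetricProjection_projLin 𝒯 k hM).isIdempotentElem).trace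
  rw [projRange, ← h, projLin, show Matrix.toEuclideanLin (projMat 𝒯 k) = _ from
    LinearEquiv.congr_fun (Matrix.toLpLin_eq_toLin 2 2) _, Matrix.trace_toLin_eq]

theorem norm_proj_sq (hM : 0 < M) (x : Data M T) :
    ‖proj 𝒯 k x‖ ^ 2 =
      ∑ d ∈ freqs 𝒯 k, freqWeight 𝒯 k d *
        ‖contrastVec 𝒯 k d ⬝ᵥ fun n => (x n : ℂ)‖ ^ 2 := by
  -- Symmetry and idempotence give `‖P x‖² = ⟨x, P x⟩`.
  have h1 : ‖proj 𝒯 k x‖ ^ 2 = x.ofLp ⬝ᵥ (projMat 𝒯 k *ᵥ x.ofLp) := by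
    have hs := (isSymmetricProjection_projLin 𝒯 k hM)
    rw [← real_inner_self_eq_norm_sq, ← projLin_apply, hs.isSymmetric,
      ← LinearMap.comp_apply, show projLin 𝒯 k ∘ₗ projLin 𝒯 k = projLin 𝒯 k from
        hs.isIdempotentElem, real_inner_comm]
    rfl
  rw [h1, projMat_eq_sum, Matrix.sum_mulVec, dotProduct_sum]
  refine Finset.sum_congr rfl fun d _ => ?_
  rw [Matrix.smul_mulVec, rePart_mulVec, dotProduct_smul, dotProduct_add, dotProduct_smul,
    dotProduct_smul, dotProduct_eq_re_im, ← Complex.normSq_eq_norm_sq, Complex.normSq_add_mul_I,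
    show (vecRe fun n => (x n : ℂ)) = x.ofLp from rfl,
    show (vecIm fun n => (x n : ℂ)) = 0 from rfl, dotProduct_comm x.ofLp, dotProduct_comm x.ofLp]
  simp [pow_two]

theorem sum_segVec_singleton (d a b : ℕ) (n : Fin (T * M)) :
    ∑ t ∈ Finset.Icc a b, segVec M T d t t n = segVec M T d a b n := by
  simp only [segVec, ← Finset.sum_mul]
  congr 1
  have : ∀ t, (t ≤ (n.divNat : ℕ) + 1 ∧ (n.divNat : ℕ) + 1 ≤ t) ↔ t = (n.divNat : ℕ) + 1 := by
    intro t; omega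
  simp_rw [this]
  rw [Finset.sum_ite_eq']
  simp

theorem sum_spectrum (d a b : ℕ) (x : Data M T) :
    ∑ t ∈ Finset.Icc a b, spectrum M T d t x = segVec M T d a b ⬝ᵥ fun n => (x n : ℂ) := by
  simp only [spectrum, dotProduct]
  rw [Finset.sum_comm]
  refine Finset.sum_congr rfl fun n _ => ?_
  rw [← Finset.sum_mul, sum_segVec_singleton]

theorem contrastVec_dotProduct (d : Fin (M / 2 + 1)) (x : Data M T) :
    contrastVec 𝒯 k d ⬝ᵥ (fun n => (x n : ℂ)) =
      (1 / ((loc 𝒯 k : ℂ) - pre 𝒯 k d)) *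
        ∑ t ∈ Finset.Icc (pre 𝒯 k d + 1) (loc 𝒯 k), spectrum M T d t x -
      (1 / ((suc 𝒯 k d : ℂ) - loc 𝒯 k)) *
        ∑ t ∈ Finset.Icc (loc 𝒯 k + 1) (suc 𝒯 k d), spectrum M T d t x := by
  rw [contrastVec, sub_dotProduct, smul_dotProduct, smul_dotProduct, sum_spectrum, sum_spectrum,
    smul_eq_mul, smul_eq_mul]

theorem testStat_eq_norm_proj (hM : 0 < M) (σ : ℝ) (x : Data M T) :
    testStat σ 𝒯 k x = σ⁻¹ * ‖proj 𝒯 k x‖ := by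
  rw [testStat, ← Real.sqrt_sq (norm_nonneg (proj 𝒯 k x)), norm_proj_sq 𝒯 k hM]
  congr 2
  refine Finset.sum_congr rfl fun d _ => ?_
  rw [contrastVec_dotProduct, freqWeight, avgSpectrum, avgSpectrum]
  -- The averages start at `pre + 1` and `loc + 1`, so `b - a + 1` becomes the plain difference of
  -- endpoints.
  congr 6 <;> push_cast <;> ring

/-- The null hypothesis says that every contrast in `𝒟_k` annihilates `s`, and `‖P_k s‖²` is a
weighted sum of those squared contrasts. -/
theorem proj_eq_zero_of_nullHyp {ν : Measure (Data M T)} (hM : 0 < M) {s : Data M T}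
    (hmean : ∀ d t, meanSpectrum ν d t = spectrum M T d t s) (h : NullHyp ν 𝒯 k) :
    proj 𝒯 k s = 0 := by
  rw [← norm_eq_zero, ← sq_eq_zero_iff, norm_proj_sq 𝒯 k hM]
  refine Finset.sum_eq_zero fun d hd => ?_
  have := h d hd
  simp only [hmean] at this
  rw [contrastVec_dotProduct, this]
  simp

end Projection

/-! ### Joint law of the test statistic and the nuisance statistic. -/

section JointLaw

variable {M T : ℕ}

theorem multivariateGaussian_smul_one {σ : ℝ} (s : Data M T) :
    multivariateGaussian s (σ ^ 2 • 1) =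
      (stdGaussian (Data M T)).map (fun x => s + σ • x) := by
  refine Measure.ext_of_charFun ?_
  ext t
  have hm : Measurable fun x : Data M T => s + σ • x := by fun_prop
  have hps : (σ ^ 2 • (1 : Matrix (Fin (T * M)) (Fin (T * M)) ℝ)).PosSemidef :=
    Matrix.PosSemidef.one.smul (sq_nonneg σ)
  rw [charFun_multivariateGaussian hps, charFun_apply, integral_map hm.aemeasurable (by fun_prop)]
  have h1 : ∀ x : Data M T, Complex.exp (inner ℝ (s + σ • x) t * Complex.I) =
      Complex.exp (inner ℝ s t * Complex.I) * Complex.exp (inner ℝ x (σ • t) * Complex.I) := by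
    intro x
    rw [← Complex.exp_add, ← add_mul, inner_add_left, real_inner_smul_left, real_inner_smul_right]
    push_cast; rfl
  simp_rw [h1]
  rw [integral_const_mul, ← charFun_apply, charFun_stdGaussian, ← Complex.exp_add,
    real_inner_comm]
  congr 1
  have h2 : t.ofLp ⬝ᵥ (σ ^ 2 • (1 : Matrix (Fin (T * M)) (Fin (T * M)) ℝ)) *ᵥ t.ofLp =
      σ ^ 2 * ‖t‖ ^ 2 := by
    rw [Matrix.smul_mulVec, Matrix.one_mulVec, dotProduct_smul, ← real_inner_self_eq_norm_sq]
    rfl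
  rw [h2, norm_smul, ← Complex.ofReal_pow, mul_pow, Real.norm_eq_abs, sq_abs]
  push_cast
  ring

theorem spectrum_continuousLinear (d t : ℕ) :
    ∃ L : Data M T →L[ℝ] ℂ, ∀ x, spectrum M T d t x = L x :=
  ⟨∑ n, (segVec M T d t t n) • (Complex.ofRealCLM ∘L
    (EuclideanSpace.proj n : Data M T →L[ℝ] ℝ)), fun x => by simp [spectrum]⟩

theorem meanSpectrum_multivariateGaussian (s : Data M T) (S : Matrix (Fin (T * M)) (Fin (T * M)) ℝ)
    (d t : ℕ) : meanSpectrum (multivariateGaussian s S) d t = spectrum M T d t s := by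
  obtain ⟨L, hL⟩ := spectrum_continuousLinear (M := M) (T := T) d t
  simp only [meanSpectrum, hL]
  rw [L.integral_comp_comm IsGaussian.integrable_fun_id, integral_id_multivariateGaussian]

theorem continuous_proj (𝒯 : Candidates M T) (k : ℕ) : Continuous (proj 𝒯 k) :=
  (projLin 𝒯 k).continuous_of_finiteDimensional

@[fun_prop]
theorem measurable_proj (𝒯 : Candidates M T) (k : ℕ) : Measurable (proj 𝒯 k) :=
  (continuous_proj 𝒯 k).measurable

theorem measurable_nuisance (σ : ℝ) (𝒯 : Candidates M T) (k : ℕ) :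
    Measurable (nuisance σ 𝒯 k) := by
  unfold nuisance nuisV nuisU
  fun_prop

theorem measurable_testStat (hM : 0 < M) (σ : ℝ) (𝒯 : Candidates M T) (k : ℕ) :
    Measurable (testStat σ 𝒯 k) := by
  rw [funext (testStat_eq_norm_proj 𝒯 k hM σ)]
  fun_prop

/-- The data are recovered from `(𝒬, T_k)`, so any event in the data is an event in this pair. If
`P_k x = 0`, division by zero gives `𝒱(x) = 0` and the identity survives. -/
theorem nuisU_add_testStat_smul_nuisV (hM : 0 < M) {σ : ℝ} (hσ : 0 < σ) (𝒯 : Candidates M T)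
    (k : ℕ) (x : Data M T) :
    nuisU 𝒯 k x + testStat σ 𝒯 k x • nuisV σ 𝒯 k x = x := by
  have h : testStat σ 𝒯 k x • nuisV σ 𝒯 k x = proj 𝒯 k x := by
    rw [testStat_eq_norm_proj 𝒯 k hM, nuisV, smul_smul]
    by_cases h0 : proj 𝒯 k x = 0
    · simp [h0]
    · have : ‖proj 𝒯 k x‖ ≠ 0 := norm_ne_zero_iff.2 h0
      rw [show σ⁻¹ * ‖proj 𝒯 k x‖ * (σ / ‖proj 𝒯 k x‖) = 1 by field_simp, one_smul]
  rw [h, nuisU, sub_add_cancel]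

/-- With `P_k s = 0`, the component `a` in the range supplies the norm and direction, and `b` alone
supplies `𝒰`. -/
theorem nuisance_testStat_polar (hM : 0 < M) {σ : ℝ} (hσ : 0 < σ) (𝒯 : Candidates M T) (k : ℕ)
    {s : Data M T} (hs : proj 𝒯 k s = 0) (b : (projRange 𝒯 k)ᗮ) (a : projRange 𝒯 k) :
    (nuisance σ 𝒯 k (s + σ • ((a : Data M T) + b)), testStat σ 𝒯 k (s + σ • ((a : Data M T) + b))) =
      ((σ • ((‖a‖⁻¹ • a : projRange 𝒯 k) : Data M T), s + σ • (b : Data M T)), ‖a‖) := by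
  have hp : proj 𝒯 k (s + σ • ((a : Data M T) + b)) = σ • (a : Data M T) := by
    rw [proj_eq_starProjection 𝒯 k hM] at hs ⊢
    rw [map_add, hs, zero_add, map_smul, map_add, Submodule.starProjection_eq_self_iff.2 a.2,
      (Submodule.starProjection_apply_eq_zero_iff _).2 b.2, add_zero]
  have hn : ‖σ • (a : Data M T)‖ = σ * ‖a‖ := by
    rw [norm_smul, Real.norm_of_nonneg hσ.le, Submodule.coe_norm]
  rw [nuisance, nuisV, nuisU, testStat_eq_norm_proj 𝒯 k hM, hp, hn]
  refine Prod.ext (Prod.ext ?_ ?_) ?_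
  · simp only [Submodule.coe_smul, smul_smul]
    congr 1
    rw [div_mul_eq_mul_div, mul_div_mul_left _ _ hσ.ne', div_eq_mul_inv]
  · simp only [smul_add]; abel
  · simp only
    rw [inv_mul_cancel_left₀ hσ.ne']

/-- Under the null hypothesis the test statistic has a `χ` distribution with `tr P_k` degrees of
freedom and is independent of the nuisance statistic. The law of the latter is `η` up to a constant
factor. -/
theorem exists_map_nuisance_testStat (hM : 0 < M) {σ : ℝ} (hσ : 0 < σ) (𝒯 : Candidates M T)
    (k : ℕ) {s : Data M T} (hs : proj 𝒯 k s = 0) (hne : (freqs 𝒯 k).Nonempty) :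
    IsFiniteMeasure (chiMeasure (projMat 𝒯 k).trace) ∧
    ∃ η : Measure (Data M T × Data M T), IsFiniteMeasure η ∧
      (multivariateGaussian s (σ ^ 2 • 1)).map (fun x => (nuisance σ 𝒯 k x, testStat σ 𝒯 k x)) =
        η.prod (chiMeasure (projMat 𝒯 k).trace) := by
  have htr := trace_projMat_pos 𝒯 k hM hne
  rw [trace_projMat 𝒯 k hM] at htr ⊢
  set K := projRange 𝒯 k with hK
  have hrank : 0 < Module.finrank ℝ K := by exact_mod_cast htr
  have : Nontrivial K := Module.finrank_pos_iff.1 hrank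
  have : NeZero (Module.finrank ℝ K) := ⟨hrank.ne'⟩
  have hfin : IsFiniteMeasure (chiMeasure (Module.finrank ℝ K)) := inferInstance
  refine ⟨hfin, ?_⟩
  obtain ⟨θ, hθ, hpolar⟩ := exists_map_polar_stdGaussian (E := K)
  set h : Kᗮ × K → Data M T × Data M T := fun p => (σ • (p.2 : Data M T), s + σ • (p.1 : Data M T))
    with hh
  have hhm : Measurable h := by fun_prop
  refine ⟨((stdGaussian Kᗮ).prod θ).map h, inferInstance, ?_⟩
  have hstat : Measurable fun x => (nuisance σ 𝒯 k x, testStat σ 𝒯 k x) :=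
    (measurable_nuisance σ 𝒯 k).prodMk (measurable_testStat hM σ 𝒯 k)
  have hpm : Measurable fun a : K => (‖a‖⁻¹ • a, ‖a‖) := by fun_prop
  set g : Kᗮ × (K × ℝ) → (Data M T × Data M T) × ℝ := fun p => (h (p.1, p.2.1), p.2.2) with hg
  have hgm : Measurable g := by fun_prop
  -- The statistics factor through the polar map on `K`, so their law is the image of a product
  -- measure with the radius kept as a separate factor.
  have hcomp : (fun x => (nuisance σ 𝒯 k x, testStat σ 𝒯 k x)) ∘ (fun x => s + σ • x) ∘
      (fun p : Kᗮ × K => (p.2 : Data M T) + p.1) =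
      g ∘ Prod.map id (fun a : K => (‖a‖⁻¹ • a, ‖a‖)) := by
    funext p
    exact nuisance_testStat_polar hM hσ 𝒯 k hs p.1 p.2
  rw [multivariateGaussian_smul_one, stdGaussian_eq_map_add K, Measure.map_map hstat (by fun_prop),
    Measure.map_map (hstat.comp (by fun_prop)) (by fun_prop), Function.comp_assoc, hcomp,
    ← Measure.map_map hgm (by fun_prop),
    ← Measure.map_prod_map _ _ measurable_id hpm, hpolar, Measure.map_id, ← Measure.prodAssoc_prod,
    Measure.map_map hgm MeasurableEquiv.prodAssoc.measurable]
  have hcomp' : g ∘ (MeasurableEquiv.prodAssoc : (Kᗮ × K) × ℝ ≃ᵐ Kᗮ × K × ℝ) = Prod.map h id := rfl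
  rw [hcomp', ← Measure.map_prod_map _ _ hhm measurable_id, Measure.map_id]

end JointLaw

/-! ### The selective p-value: truncated χ form and uniformity. -/

section SelectivePValue

variable {M T : ℕ} {𝒜 : Data M T → Candidates M T}

theorem measurableSet_preimage_candidates (h𝒜 : ∀ 𝒯, MeasurableSet (𝒜 ⁻¹' {𝒯}))
    (C : Set (Candidates M T)) : MeasurableSet (𝒜 ⁻¹' C) := by
  rw [← biUnion_of_singleton C, preimage_iUnion₂]
  exact MeasurableSet.biUnion (Set.to_countable C) fun 𝒯 _ => h𝒜 𝒯

/-- On each of the finitely many selection events the statistics are built from fixed candidates,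
and the p-value is a measurable function of them. -/
theorem measurableSet_selectivePValue_le (hM : 0 < M) (ν : Measure (Data M T)) (σ : ℝ)
    (h𝒜 : ∀ 𝒯, MeasurableSet (𝒜 ⁻¹' {𝒯})) (k : ℕ) (α : ℝ) :
    MeasurableSet {x | selectivePValue ν σ 𝒜 k x ≤ α} := by
  have h : {x | selectivePValue ν σ 𝒜 k x ≤ α} = ⋃ 𝒯, 𝒜 ⁻¹' {𝒯} ∩
      {x | (condDistrib (testStat σ 𝒯 k) (nuisance σ 𝒯 k) (cond ν (𝒜 ⁻¹' {𝒯}))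
        (nuisance σ 𝒯 k x)).real (Ici (testStat σ 𝒯 k x)) ≤ α} := by
    ext x
    simp only [mem_iUnion, mem_inter_iff, mem_preimage, mem_singleton_iff, mem_ofPred_eq]
    exact ⟨fun hx => ⟨𝒜 x, rfl, hx⟩, by rintro ⟨_, rfl, hx⟩; exact hx⟩
  rw [h]
  refine MeasurableSet.iUnion fun 𝒯 => (h𝒜 𝒯).inter ?_
  exact ((measurable_kernel_real_Ici _).comp
    ((measurable_nuisance σ 𝒯 k).prodMk (measurable_testStat hM σ 𝒯 k))) measurableSet_Iic

theorem selectivePValue_of_eq (ν : Measure (Data M T)) (σ : ℝ) (k : ℕ) {𝒯 : Candidates M T}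
    {x : Data M T} (h : 𝒜 x = 𝒯) : selectivePValue ν σ 𝒜 k x =
      (condDistrib (testStat σ 𝒯 k) (nuisance σ 𝒯 k) (cond ν (𝒜 ⁻¹' {𝒯}))
        (nuisance σ 𝒯 k x)).real (Ici (testStat σ 𝒯 k x)) := by
  subst h
  rw [selectivePValue]

/-- The conditional distribution of the test statistic given the selection event and the nuisance
statistic is a truncated `χ` distribution. -/
theorem condDistrib_testStat_ae_eq (hM : 0 < M) {σ : ℝ} (hσ : 0 < σ) (s : Data M T)
    (h𝒜 : ∀ 𝒯, MeasurableSet (𝒜 ⁻¹' {𝒯})) (k : ℕ) {𝒯 : Candidates M T}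
    (hk : k ∈ Finset.Icc 1 (locations 𝒯).card)
    (hnull : NullHyp (multivariateGaussian s (σ ^ 2 • 1)) 𝒯 k) :
    ∀ᵐ q ∂((cond (multivariateGaussian s (σ ^ 2 • 1)) (𝒜 ⁻¹' {𝒯})).map (nuisance σ 𝒯 k)),
      condDistrib (testStat σ 𝒯 k) (nuisance σ 𝒯 k)
        (cond (multivariateGaussian s (σ ^ 2 • 1)) (𝒜 ⁻¹' {𝒯})) q =
      truncChi (projMat 𝒯 k).trace {z | 𝒜 (q.2 + z • q.1) = 𝒯} := by
  have hs := proj_eq_zero_of_nullHyp 𝒯 k hM (meanSpectrum_multivariateGaussian s _) hnull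
  obtain ⟨hfin, η, hη, hlaw⟩ := exists_map_nuisance_testStat hM hσ 𝒯 k hs (freqs_nonempty hk)
  -- `S` is the selection event in the coordinates `(𝒬, T_k)`; its sections are the truncation
  -- regions.
  have hS : MeasurableSet {p : (Data M T × Data M T) × ℝ | 𝒜 (p.1.2 + p.2 • p.1.1) = 𝒯} :=
    (show Measurable fun p : (Data M T × Data M T) × ℝ => p.1.2 + p.2 • p.1.1 by fun_prop) (h𝒜 𝒯)
  refine condDistrib_cond_preimage_ae_eq _ (measurable_nuisance σ 𝒯 k)
    (measurable_testStat hM σ 𝒯 k) _ η hlaw hS ?_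
  ext x
  simp [nuisance, nuisU_add_testStat_smul_nuisV hM hσ]

theorem selectivePValue_ae_eq (hM : 0 < M) {σ : ℝ} (hσ : 0 < σ) (s : Data M T)
    (h𝒜 : ∀ 𝒯, MeasurableSet (𝒜 ⁻¹' {𝒯})) (k : ℕ) {𝒯 : Candidates M T}
    (hk : k ∈ Finset.Icc 1 (locations 𝒯).card)
    (hnull : NullHyp (multivariateGaussian s (σ ^ 2 • 1)) 𝒯 k) :
    ∀ᵐ x ∂(cond (multivariateGaussian s (σ ^ 2 • 1)) (𝒜 ⁻¹' {𝒯})),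
      selectivePValue (multivariateGaussian s (σ ^ 2 • 1)) σ 𝒜 k x =
        (truncChi (projMat 𝒯 k).trace (truncRegion σ 𝒜 k x)).real (Ici (testStat σ 𝒯 k x)) := by
  filter_upwards [ae_of_ae_map (measurable_nuisance σ 𝒯 k).aemeasurable
    (condDistrib_testStat_ae_eq hM hσ s h𝒜 k hk hnull), ae_cond_mem (h𝒜 𝒯)] with x hx hmem
  obtain rfl : 𝒜 x = 𝒯 := hmem
  rw [selectivePValue, hx]
  rfl

theorem cond_selectivePValue_le (hM : 0 < M) {σ : ℝ} (hσ : 0 < σ) (s : Data M T)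
    (h𝒜 : ∀ 𝒯, MeasurableSet (𝒜 ⁻¹' {𝒯})) (k : ℕ) {𝒯 : Candidates M T}
    (hk : k ∈ Finset.Icc 1 (locations 𝒯).card)
    (hnull : NullHyp (multivariateGaussian s (σ ^ 2 • 1)) 𝒯 k)
    (hpos : multivariateGaussian s (σ ^ 2 • 1) (𝒜 ⁻¹' {𝒯}) ≠ 0) {α : ℝ}
    (hα : α ∈ Ioo (0 : ℝ) 1) :
    cond (multivariateGaussian s (σ ^ 2 • 1)) (𝒜 ⁻¹' {𝒯})
      {x | selectivePValue (multivariateGaussian s (σ ^ 2 • 1)) σ 𝒜 k x ≤ α} =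
        ENNReal.ofReal α := by
  have := cond_isProbabilityMeasure hpos
  rw [← measure_condDistrib_Ici_le (cond (multivariateGaussian s (σ ^ 2 • 1)) (𝒜 ⁻¹' {𝒯}))
    (measurable_nuisance σ 𝒯 k) (measurable_testStat hM σ 𝒯 k) ?_ hα]
  · refine measure_congr ?_
    filter_upwards [ae_cond_mem (h𝒜 𝒯)] with x hmem
    exact propext (Iff.of_eq (congrArg (· ≤ α) (selectivePValue_of_eq _ σ k hmem)))
  · filter_upwards [condDistrib_testStat_ae_eq hM hσ s h𝒜 k hk hnull] with q hq t
    rw [hq, truncChi]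
    exact cond_absolutelyContinuous (chiMeasure_singleton _ t)

/-- Total probability over the collections that satisfy the null hypothesis; those of probability
zero contribute nothing to either side. -/
theorem measure_selectivePValue_le_inter (hM : 0 < M) {σ : ℝ} (hσ : 0 < σ) (s : Data M T)
    (h𝒜 : ∀ 𝒯, MeasurableSet (𝒜 ⁻¹' {𝒯})) (k : ℕ) {α : ℝ} (hα : α ∈ Ioo (0 : ℝ) 1) :
    multivariateGaussian s (σ ^ 2 • 1)
      ({x | k ∈ Finset.Icc 1 (locations (𝒜 x)).card ∧
          NullHyp (multivariateGaussian s (σ ^ 2 • 1)) (𝒜 x) k} ∩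
        {x | selectivePValue (multivariateGaussian s (σ ^ 2 • 1)) σ 𝒜 k x ≤ α}) =
      ENNReal.ofReal α * multivariateGaussian s (σ ^ 2 • 1)
        {x | k ∈ Finset.Icc 1 (locations (𝒜 x)).card ∧
          NullHyp (multivariateGaussian s (σ ^ 2 • 1)) (𝒜 x) k} := by
  classical
  set ν := multivariateGaussian s (σ ^ 2 • 1) with hν
  set D := {x | selectivePValue ν σ 𝒜 k x ≤ α} with hD
  have hDm : MeasurableSet D := measurableSet_selectivePValue_le hM ν σ h𝒜 k α
  have hfinite : Fintype (Candidates M T) := Fintype.ofFinite _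
  set C : Finset (Candidates M T) :=
    Finset.univ.filter fun 𝒯 => k ∈ Finset.Icc 1 (locations 𝒯).card ∧ NullHyp ν 𝒯 k with hC
  have hG : {x | k ∈ Finset.Icc 1 (locations (𝒜 x)).card ∧ NullHyp ν (𝒜 x) k} =
      ⋃ 𝒯 ∈ C, 𝒜 ⁻¹' {𝒯} := by
    ext x
    simp [hC]
  have hdisj : Pairwise fun 𝒯 𝒯' : Candidates M T => Disjoint (𝒜 ⁻¹' {𝒯}) (𝒜 ⁻¹' {𝒯'}) :=
    fun 𝒯 𝒯' h => Disjoint.preimage _ (by simpa using h)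
  rw [hG, iUnion₂_inter, measure_biUnion_finset (fun 𝒯 _ 𝒯' _ h => (hdisj h).mono
    inter_subset_left inter_subset_left) (fun 𝒯 _ => (h𝒜 𝒯).inter hDm),
    measure_biUnion_finset (fun 𝒯 _ 𝒯' _ h => hdisj h) (fun 𝒯 _ => h𝒜 𝒯), Finset.mul_sum]
  refine Finset.sum_congr rfl fun 𝒯 h𝒯 => ?_
  by_cases hpos : ν (𝒜 ⁻¹' {𝒯}) = 0
  · rw [hpos, mul_zero]
    exact measure_mono_null inter_subset_left hpos
  · obtain ⟨-, hk, hnull⟩ := Finset.mem_filter.1 h𝒯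
    rw [← cond_mul_eq_inter (h𝒜 𝒯), cond_selectivePValue_le hM hσ s h𝒜 k hk hnull hpos hα]

/-- Transports statements about the law of the data, conditioned on selection, to the underlying
probability space. -/
theorem map_cond_preimage {Ω E : Type*} [MeasurableSpace Ω] [MeasurableSpace E] {P : Measure Ω}
    {ν : Measure E} {X : Ω → E} (hX : HasLaw X ν P) {B : Set E} (hB : MeasurableSet B) :
    (cond P (X ⁻¹' B)).map X = cond ν B := by
  rw [ProbabilityTheory.cond, ProbabilityTheory.cond, Measure.map_smul, ← hX.map_eq,
    Measure.restrict_map_of_aemeasurable hX.aemeasurable hB,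
    Measure.map_apply_of_aemeasurable hX.aemeasurable hB]

theorem aemeasurable_cond {Ω E : Type*} [MeasurableSpace Ω] [MeasurableSpace E] {P : Measure Ω}
    {X : Ω → E} (hX : AEMeasurable X P) (B : Set Ω) : AEMeasurable X (cond P B) :=
  hX.mono_ac cond_absolutelyContinuous

end SelectivePValue

end SpectralCP

theorem theorem2 {Ω : Type*} [MeasurableSpace Ω] (P : Measure Ω) [IsProbabilityMeasure P]
    (M T : ℕ) (hM : 0 < M) (σ : ℝ) (hσ : 0 < σ) (s : SpectralCP.Data M T)
    (ν : Measure (SpectralCP.Data M T)) (hν : ν = multivariateGaussian s (σ ^ 2 • 1))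
    (X : Ω → SpectralCP.Data M T) (hX : HasLaw X ν P)
    (𝒜 : SpectralCP.Data M T → SpectralCP.Candidates M T)
    (h𝒜 : ∀ 𝒯, MeasurableSet (𝒜 ⁻¹' {𝒯})) (k : ℕ) :
    -- conditional on the selected candidates
    (∀ x : SpectralCP.Data M T,
      k ∈ Finset.Icc 1 (SpectralCP.locations (𝒜 x)).card →
      SpectralCP.NullHyp ν (𝒜 x) k →
      P {ω | 𝒜 (X ω) = 𝒜 x} ≠ 0 →
        (∀ᵐ ω ∂(cond P {ω | 𝒜 (X ω) = 𝒜 x}),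
          SpectralCP.selectivePValue ν σ 𝒜 k (X ω) =
            (SpectralCP.truncChi (SpectralCP.projMat (𝒜 x) k).trace
              (SpectralCP.truncRegion σ 𝒜 k (X ω))).real
                (Ici (SpectralCP.testStat σ (𝒜 x) k (X ω)))) ∧
        ∀ α ∈ Ioo (0 : ℝ) 1,
          cond P {ω | 𝒜 (X ω) = 𝒜 x} {ω | SpectralCP.selectivePValue ν σ 𝒜 k (X ω) ≤ α} =
            ENNReal.ofReal α) ∧
    -- marginally, given that a `k`-th location is selected and its null hypothesis is true
    (P {ω | k ∈ Finset.Icc 1 (SpectralCP.locations (𝒜 (X ω))).card ∧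
          SpectralCP.NullHyp ν (𝒜 (X ω)) k} ≠ 0 →
      ∀ α ∈ Ioo (0 : ℝ) 1,
        cond P {ω | k ∈ Finset.Icc 1 (SpectralCP.locations (𝒜 (X ω))).card ∧
            SpectralCP.NullHyp ν (𝒜 (X ω)) k}
          {ω | SpectralCP.selectivePValue ν σ 𝒜 k (X ω) ≤ α} = ENNReal.ofReal α) ∧
    -- unconditionally, if almost surely the `k`-th location exists and its null hypothesis is true
    ((∀ᵐ ω ∂P, k ∈ Finset.Icc 1 (SpectralCP.locations (𝒜 (X ω))).card ∧
          SpectralCP.NullHyp ν (𝒜 (X ω)) k) →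
      ∀ α ∈ Ioo (0 : ℝ) 1,
        P {ω | SpectralCP.selectivePValue ν σ 𝒜 k (X ω) ≤ α} = ENNReal.ofReal α) := by
  subst hν
  set ν := multivariateGaussian s (σ ^ 2 • 1) with hν
  have hD : ∀ α, MeasurableSet {x | SpectralCP.selectivePValue ν σ 𝒜 k x ≤ α} :=
    SpectralCP.measurableSet_selectivePValue_le hM ν σ h𝒜 k
  set G : Set (SpectralCP.Data M T) := {x | k ∈ Finset.Icc 1 (SpectralCP.locations (𝒜 x)).card ∧
    SpectralCP.NullHyp ν (𝒜 x) k} with hG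
  have hGm : MeasurableSet G := SpectralCP.measurableSet_preimage_candidates h𝒜
    {𝒯 | k ∈ Finset.Icc 1 (SpectralCP.locations 𝒯).card ∧ SpectralCP.NullHyp ν 𝒯 k}
  have hmarg : P (X ⁻¹' G) ≠ 0 → ∀ α ∈ Ioo (0 : ℝ) 1,
      cond P (X ⁻¹' G) (X ⁻¹' {x | SpectralCP.selectivePValue ν σ 𝒜 k x ≤ α}) =
        ENNReal.ofReal α := by
    intro hpos α hα
    rw [← Measure.map_apply_of_aemeasurable (SpectralCP.aemeasurable_cond hX.aemeasurable _) (hD α),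
      SpectralCP.map_cond_preimage hX hGm, cond_apply hGm,
      SpectralCP.measure_selectivePValue_le_inter hM hσ s h𝒜 k hα]
    rw [← Measure.map_apply_of_aemeasurable hX.aemeasurable hGm, hX.map_eq] at hpos
    rw [mul_comm, mul_assoc, ENNReal.mul_inv_cancel hpos (measure_ne_top _ _), mul_one]
  refine ⟨fun x hk hnull hpos => ?_, hmarg, fun hae α hα => ?_⟩
  · change P (X ⁻¹' (𝒜 ⁻¹' {𝒜 x})) ≠ 0 at hpos
    have hmap := SpectralCP.map_cond_preimage hX (h𝒜 (𝒜 x))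
    have haem := SpectralCP.aemeasurable_cond hX.aemeasurable (X ⁻¹' (𝒜 ⁻¹' {𝒜 x}))
    refine ⟨?_, fun α hα => ?_⟩
    · have h := SpectralCP.selectivePValue_ae_eq hM hσ s h𝒜 k hk hnull
      rw [← hν, ← hmap] at h
      exact ae_of_ae_map haem h
    · change cond P (X ⁻¹' (𝒜 ⁻¹' {𝒜 x}))
        (X ⁻¹' {x | SpectralCP.selectivePValue ν σ 𝒜 k x ≤ α}) = _
      rw [← Measure.map_apply_of_aemeasurable haem (hD α), hmap]
      rw [← Measure.map_apply_of_aemeasurable hX.aemeasurable (h𝒜 _), hX.map_eq] at hpos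
      exact SpectralCP.cond_selectivePValue_le hM hσ s h𝒜 k hk hnull hpos hα
  · have hae' : ∀ᵐ ω ∂P, ω ∈ X ⁻¹' G := hae
    have h1 : P (X ⁻¹' G) = 1 := 
      (measure_congr (Filter.eventuallyEq_univ.2 hae')).trans measure_univ
    have h2 := hmarg (by rw [h1]; exact one_ne_zero) α hα
    -- Conditioning on an event of probability one changes nothing.
    rw [ProbabilityTheory.cond, h1, inv_one, one_smul,
      Measure.restrict_eq_self_of_ae_mem hae'] at h2
    exact h2
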